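/- Setting. Let $a^\dagger_\alpha(I), b^{\dagger\alpha}(I)$ ($I=1,2,3$ labelling the legs of a trivalent vertex, $\alpha=1,2,3$ the colours) be the creation operators of eighteen independent bosonic oscillators, with adjoints $a^\alpha(I), b_\alpha(I)$, acting on the bosonic Fock space with vacuum $|0\rangle$, $\langle 0|0\rangle=1$. For each leg put $P_I=a^\dagger(I)\cdot a(I)$, $Q_I=b^\dagger(I)\cdot b(I)$ and define the irreducible Schwinger boson creation operators $$A^\dagger_\alpha(I)=a^\dagger_\alpha(I)-\tfrac{1}{P_I+Q_I+1}\,(a^\dagger(I)\cdot b^\dagger(I))\,b_\alpha(I),\qquad B^{\dagger\alpha}(I)=b^{\dagger\alpha}(I)-\tfrac{1}{P_I+Q_I+1}\,(a^\dagger(I)\cdot b^\dagger(I))\,a^\alpha(I).$$ Let $L^\dagger_{IJ}=\sum_\alpha A^\dagger_\alpha(I)B^{\dagger\alpha}(J)$ for $I\ne J$, $T_A^\dagger=\epsilon^{\alpha\beta\gamma}A^\dagger_\alpha(1)A^\dagger_\beta(2)A^\dagger_\gamma(3)$, $T_B^\dagger=\epsilon_{\alpha\beta\gamma}B^{\dagger\alpha}(1)B^{\dagger\beta}(2)B^{\dagger\gamma}(3)$.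 For $\ell_{IJ}\in\mathbb{N}_0$ ($I\neq J$) and $t\in\mathbb{Z}$ the naive LSH ket is $$\|\ell;t\rangle\!\rangle=(L^\dagger_{12})^{\ell_{12}}(L^\dagger_{23})^{\ell_{23}}(L^\dagger_{31})^{\ell_{31}}(L^\dagger_{21})^{\ell_{21}}(L^\dagger_{32})^{\ell_{32}}(L^\dagger_{13})^{\ell_{13}}\,|t\rangle,\qquad |t\rangle=\begin{cases}(T_A^\dagger)^{t}|0\rangle & t\ge 0,\\ (T_B^\dagger)^{-t}|0\rangle & t<0.\end{cases}$$ Its sector is $(p_1,q_1,p_2,q_2,p_3,q_3)$ with $p_I=\sum_{J\ne I}\ell_{IJ}+\max(t,0)$ and $q_I=\sum_{J\neq I}\ell_{JI}+\max(-t,0)$. A label $(\ell;t)$ is called nondegenerate if no other label has the same sector. Theorem. (0) Every naive ket satisfies $P_I\|\ell;t\rangle\!\rangle=p_I\|\ell;t\rangle\!\rangle$ and $Q_I\|\ell;t\rangle\!\rangle=q_I\|\ell;t\rangle\!\rangle$ for $I=1,2,3$. (1) A label is nondegenerate if and only if, for some arrangement $(I,J,K)$ of the three legs, $\ell_{KI}=0$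 and in addition $\ell_{IK}=0$ (Class I), or $\ell_{KJ}=0$ (Class IIa), or $\ell_{JI}=0$ (Class IIb). (2) For every label in one of these classes with respect to $(I,J,K)$, the following holds. Class I: $\|\ell;t\rangle\!\rangle=(L_{IJ}^\dagger)^{\ell_{IJ}}(L_{JK}^\dagger)^{\ell_{JK}}(L_{JI}^\dagger)^{\ell_{JI}}(L_{KJ}^\dagger)^{\ell_{KJ}}|t\rangle$, with squared norm $$\tfrac12(\ell_{IJ}+\ell_{JI}+\ell_{JK}+\ell_{KJ}+|t|+2)\,\ell_{IJ}!\,\ell_{JK}!\,\ell_{JI}!\,\ell_{KJ}!\,|t|!\,(\ell_{IJ}+\ell_{KJ}+|t|+1)!\,(\ell_{JK}+\ell_{JI}+|t|+1)!.$$ Class IIa: $\|\ell;t\rangle\!\rangle=(L_{IJ}^\dagger)^{\ell_{IJ}}(L_{JK}^\dagger)^{\ell_{JK}}(L_{JI}^\dagger)^{\ell_{JI}}(L_{IK}^\dagger)^{\ell_{IK}}|t\rangle$, with squared norm $$\tfrac12(\ell_{IJ}+\ell_{JK}+\ell_{JI}+\ell_{IK}+|t|+2)\,\ell_{IJ}!\,\ell_{JK}!\,\ell_{JI}!\,\ell_{IK}!\,|t|!\,(\ell_{IJ}+\ell_{IK}+|t|+1)!\,(\ell_{JK}+\ell_{JI}+|t|+1)!\,\frac{\binom{\ell_{IJ}+\ell_{JK}+\ell_{JI}+\ell_{IK}+|t|+1}{\ell_{IK}}}{\binom{\ell_{IJ}+\ell_{JI}+\ell_{IK}+|t|+1}{\ell_{IK}}}.$$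 Class IIb: $\|\ell;t\rangle\!\rangle=(L_{IJ}^\dagger)^{\ell_{IJ}}(L_{JK}^\dagger)^{\ell_{JK}}(L_{KJ}^\dagger)^{\ell_{KJ}}(L_{IK}^\dagger)^{\ell_{IK}}|t\rangle$, with squared norm $$\tfrac12(\ell_{IJ}+\ell_{JK}+\ell_{KJ}+\ell_{IK}+|t|+2)\,\ell_{IJ}!\,\ell_{JK}!\,\ell_{KJ}!\,\ell_{IK}!\,|t|!\,(\ell_{IJ}+\ell_{KJ}+|t|+1)!\,(\ell_{JK}+\ell_{IK}+|t|+1)!\,\frac{\binom{\ell_{IJ}+\ell_{JK}+\ell_{KJ}+\ell_{IK}+|t|+1}{\ell_{IK}}}{\binom{\ell_{JK}+\ell_{KJ}+\ell_{IK}+|t|+1}{\ell_{IK}}}.$$ (3) Divide each nondegenerate naive ket by the square root of the closed form in (2) for any class it belongs to. The resulting kets form an orthonormal family; each of them is orthogonal to all other naive LSH kets (degenerate ones included), and each spans the span of the naive kets of its sector. -/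

import Mathlib

open MvPolynomial

noncomputable section

namespace LSH

/-! ### Bosonic Fock space of the eighteen Schwinger bosons of a trivalent vertex -/

/-- The bosonic modes at the vertex: for each of the three legs (`0, 1, 2 : Fin 3` stand for the
legs 1, 2, 3) a triplet of type `a` and a triplet of type `b`, with colour index in `Fin 3`. -/
inductive Mode : Type
  | a (leg colour : Fin 3) : Mode
  | b (leg colour : Fin 3) : Mode
  deriving DecidableEq

/-- The (algebraic) bosonic Fock space, i.e. the span of all occupation-number states, in the
Bargmann realization: `monomial m 1` is the unnormalized state
`∏ (creation operator of mode i) ^ (m i) |0⟩`. -/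
abbrev Fock : Type := MvPolynomial Mode ℂ

/-- The product of the factorials of the occupation numbers, i.e. the squared norm of the
unnormalized occupation-number state with occupation numbers `m`. -/
def occFactorial (m : Mode →₀ ℕ) : ℕ := m.prod fun _ n => n.factorial

/-- The Fock inner product (conjugate-linear in the first slot): distinct occupation-number states
are orthogonal, and the unnormalized state `m` has squared norm `∏ i, (m i)!`. -/
def fockInner (x y : Fock) : ℂ :=
  ∑ m ∈ x.support, (starRingEnd ℂ) (x.coeff m) * y.coeff m * (occFactorial m : ℂ)

theorem occFactorial_pos (m : Mode →₀ ℕ) : 0 < occFactorial m :=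
  Finset.prod_pos fun _ _ => Nat.factorial_pos _

theorem fockInner_eq_sum (x y : Fock) (S : Finset (Mode →₀ ℕ)) (h : x.support ⊆ S) :
    fockInner x y =
      ∑ m ∈ S, (starRingEnd ℂ) (x.coeff m) * y.coeff m * (occFactorial m : ℂ) := by
  refine Finset.sum_subset h fun m _ hm => ?_
  rw [MvPolynomial.notMem_support_iff.mp hm]
  simp

theorem fockInner_conj_symm (x y : Fock) : (starRingEnd ℂ) (fockInner y x) = fockInner x y := by
  classical
  rw [fockInner_eq_sum x y (x.support ∪ y.support) Finset.subset_union_left,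
    fockInner_eq_sum y x (x.support ∪ y.support) Finset.subset_union_right, map_sum]
  refine Finset.sum_congr rfl fun m _ => ?_
  simp [mul_comm]

theorem fockInner_self (x : Fock) :
    fockInner x x = ((∑ m ∈ x.support, ‖x.coeff m‖ ^ 2 * (occFactorial m : ℝ) : ℝ) : ℂ) := by
  unfold fockInner
  push_cast
  refine Finset.sum_congr rfl fun m _ => ?_
  rw [Complex.conj_mul']

theorem fockInner_add_left (x y z : Fock) :
    fockInner (x + y) z = fockInner x z + fockInner y z := by
  classical
  rw [fockInner_eq_sum (x + y) z (x.support ∪ y.support) MvPolynomial.support_add,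
    fockInner_eq_sum x z (x.support ∪ y.support) Finset.subset_union_left,
    fockInner_eq_sum y z (x.support ∪ y.support) Finset.subset_union_right,
    ← Finset.sum_add_distrib]
  refine Finset.sum_congr rfl fun m _ => ?_
  rw [MvPolynomial.coeff_add, map_add]
  ring

theorem fockInner_smul_left (x y : Fock) (r : ℂ) :
    fockInner (r • x) y = (starRingEnd ℂ) r * fockInner x y := by
  rw [fockInner_eq_sum (r • x) y x.support MvPolynomial.support_smul, fockInner,
    Finset.mul_sum]
  refine Finset.sum_congr rfl fun m _ => ?_
  rw [MvPolynomial.coeff_smul, smul_eq_mul, map_mul]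
  ring

theorem fockInner_definite (x : Fock) (h : fockInner x x = 0) : x = 0 := by
  rw [fockInner_self, Complex.ofReal_eq_zero,
    Finset.sum_eq_zero_iff_of_nonneg (fun m _ => by positivity)] at h
  ext m
  by_cases hm : m ∈ x.support
  · have h1 := h m hm
    have h2 : (occFactorial m : ℝ) ≠ 0 := by exact_mod_cast (occFactorial_pos m).ne'
    simpa [h2] using h1
  · simpa using MvPolynomial.notMem_support_iff.mp hm

/-- The Fock inner product is a (positive definite) scalar product. -/
instance fockCore : InnerProductSpace.Core ℂ Fock where
  inner := fockInner
  conj_inner_symm := fockInner_conj_symm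
  re_inner_nonneg x := by
    change 0 ≤ Complex.re (fockInner x x)
    rw [fockInner_self, Complex.ofReal_re]
    positivity
  add_left := fockInner_add_left
  smul_left := fockInner_smul_left
  definite := fockInner_definite

instance fockNormedAddCommGroup : NormedAddCommGroup Fock :=
  @InnerProductSpace.Core.toNormedAddCommGroup ℂ Fock _ _ _ fockCore

instance fockInnerProductSpace : InnerProductSpace ℂ Fock :=
  InnerProductSpace.ofCore fockCore.toCore

/-- The total bosonic vacuum. -/
def vacuum : Fock := 1

/-- Creation operator `a†_α` of leg `I`. -/
def aDag (I α : Fin 3) : Module.End ℂ Fock := LinearMap.mulLeft ℂ (X (Mode.a I α) : Fock)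

/-- Creation operator `b†^α` of leg `I`. -/
def bDag (I α : Fin 3) : Module.End ℂ Fock := LinearMap.mulLeft ℂ (X (Mode.b I α) : Fock)

/-- Annihilation operator `a^α` of leg `I`, the adjoint of `aDag I α`. -/
def aAnn (I α : Fin 3) : Module.End ℂ Fock :=
  (pderiv (Mode.a I α) : Derivation ℂ Fock Fock).toLinearMap

/-- Annihilation operator `b_α` of leg `I`, the adjoint of `bDag I α`. -/
def bAnn (I α : Fin 3) : Module.End ℂ Fock :=
  (pderiv (Mode.b I α) : Derivation ℂ Fock Fock).toLinearMap

/-- The number operator `P = a† · a` of leg `I`. -/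
def numP (I : Fin 3) : Module.End ℂ Fock := ∑ α, aDag I α * aAnn I α

/-- The number operator `Q = b† · b` of leg `I`. -/
def numQ (I : Fin 3) : Module.End ℂ Fock := ∑ α, bDag I α * bAnn I α

/-- The number of quanta on leg `I` in the occupation-number state `m`. -/
def legOcc (I : Fin 3) (m : Mode →₀ ℕ) : ℕ := ∑ α, m (Mode.a I α) + ∑ α, m (Mode.b I α)

/-- The operator `1 / (P + Q + 1)` of leg `I`, diagonal on occupation-number states. -/
def invNum (I : Fin 3) : Module.End ℂ Fock :=
  (basisMonomials Mode ℂ).constr ℂ fun m => ((legOcc I m + 1 : ℕ) : ℂ)⁻¹ • monomial m (1 : ℂ)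

/-- The operator `a† · b†` of leg `I`. -/
def abDag (I : Fin 3) : Module.End ℂ Fock := ∑ γ, aDag I γ * bDag I γ

/-! ### Irreducible Schwinger bosons and the naive LSH kets -/

/-- Irreducible Schwinger boson creation operator
`A†_α = a†_α - (P + Q + 1)⁻¹ (a† · b†) b_α` of leg `I`. -/
def ADag (I α : Fin 3) : Module.End ℂ Fock := aDag I α - invNum I * abDag I * bAnn I α

/-- Irreducible Schwinger boson creation operator
`B†^α = b†^α - (P + Q + 1)⁻¹ (a† · b†) a^α` of leg `I`. -/
def BDag (I α : Fin 3) : Module.End ℂ Fock := bDag I α - invNum I * abDag I * aAnn I α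

/-- `L†_{IJ} = A†_α(I) B†^α(J)`. -/
def LDag (I J : Fin 3) : Module.End ℂ Fock := ∑ α, ADag I α * BDag J α

/-- `T_A† = ε^{αβγ} A†_α(1) A†_β(2) A†_γ(3)`. -/
def TADag : Module.End ℂ Fock :=
  ∑ σ : Equiv.Perm (Fin 3), ((Equiv.Perm.sign σ : ℤ) : ℂ) •
    (ADag 0 (σ 0) * ADag 1 (σ 1) * ADag 2 (σ 2))

/-- `T_B† = ε_{αβγ} B†^α(1) B†^β(2) B†^γ(3)`. -/
def TBDag : Module.End ℂ Fock :=
  ∑ σ : Equiv.Perm (Fin 3), ((Equiv.Perm.sign σ : ℤ) : ℂ) •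
    (BDag 0 (σ 0) * BDag 1 (σ 1) * BDag 2 (σ 2))

/-- `(T_A†)^t |0⟩` for `t ≥ 0`, and `(T_B†)^(-t) |0⟩` for `t < 0`. -/
def tKet (t : ℤ) : Fock :=
  if 0 ≤ t then (TADag ^ t.toNat) vacuum else (TBDag ^ (-t).toNat) vacuum

/-- The labels `(ℓ₁₂, ℓ₂₃, ℓ₃₁; ℓ₂₁, ℓ₃₂, ℓ₁₃; t)` of the naive LSH kets. -/
@[ext] structure Label : Type where
  l12 : ℕ
  l23 : ℕ
  l31 : ℕ
  l21 : ℕ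
  l32 : ℕ
  l13 : ℕ
  t : ℤ

/-- `s.ell I J = ℓ_{IJ}` for `I ≠ J`; the diagonal entries, which carry no label, are zero. -/
def Label.ell (s : Label) : Fin 3 → Fin 3 → ℕ :=
  ![![0, s.l12, s.l13], ![s.l21, 0, s.l23], ![s.l31, s.l32, 0]]

/-- `|t|` as a natural number. -/
def Label.absT (s : Label) : ℕ := s.t.natAbs

/-- The naive LSH ket. -/
def naiveKet (s : Label) : Fock :=
  (LDag 0 1 ^ s.l12 * LDag 1 2 ^ s.l23 * LDag 2 0 ^ s.l31 *
    LDag 1 0 ^ s.l21 * LDag 2 1 ^ s.l32 * LDag 0 2 ^ s.l13) (tKet s.t)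

/-- `p_I = ∑_J ℓ_{IJ} + |t| θ(t)`. -/
def Label.p (s : Label) (I : Fin 3) : ℕ := ∑ J, s.ell I J + s.t.toNat

/-- `q_I = ∑_J ℓ_{JI} + |t| θ(-t)`. -/
def Label.q (s : Label) (I : Fin 3) : ℕ := ∑ J, s.ell J I + (-s.t).toNat

/-- Two labels belong to the same sector `(p₁, q₁, p₂, q₂, p₃, q₃)`. -/
def SameSector (s s' : Label) : Prop := s.p = s'.p ∧ s.q = s'.q

/-- The sector of `s` contains only one naive LSH ket, that of `s` itself. -/
def Nondegenerate (s : Label) : Prop := ∀ s' : Label, SameSector s s' → s' = s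

/-- The legs `I`, `J`, `K` are the three legs of the vertex, in some order. -/
def AreLegs (I J K : Fin 3) : Prop := I ≠ J ∧ J ≠ K ∧ K ≠ I

/-- Class I: only `ℓ_{IJ}, ℓ_{JK}, ℓ_{JI}, ℓ_{KJ}` and `t` may be nonzero. -/
def InClassI (s : Label) (I J K : Fin 3) : Prop :=
  AreLegs I J K ∧ s.ell K I = 0 ∧ s.ell I K = 0

/-- Class IIa: only `ℓ_{IJ}, ℓ_{JK}, ℓ_{JI}, ℓ_{IK}` and `t` may be nonzero. -/
def InClassIIa (s : Label) (I J K : Fin 3) : Prop :=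
  AreLegs I J K ∧ s.ell K I = 0 ∧ s.ell K J = 0

/-- Class IIb: only `ℓ_{IJ}, ℓ_{JK}, ℓ_{KJ}, ℓ_{IK}` and `t` may be nonzero. -/
def InClassIIb (s : Label) (I J K : Fin 3) : Prop :=
  AreLegs I J K ∧ s.ell K I = 0 ∧ s.ell J I = 0

/-! ### The closed-form squared norms -/

/-- Class I closed form; the arguments are `ℓ_{IJ}, ℓ_{JK}, ℓ_{JI}, ℓ_{KJ}, |t|`. -/
def normSqI (ij jk ji kj t : ℕ) : ℝ :=
  1 / 2 * ((ij + ji + jk + kj + t + 2 : ℕ) : ℝ) * (ij.factorial : ℝ) * (jk.factorial : ℝ) *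
    (ji.factorial : ℝ) * (kj.factorial : ℝ) * (t.factorial : ℝ) *
    ((ij + kj + t + 1).factorial : ℝ) * ((jk + ji + t + 1).factorial : ℝ)

/-- Class IIa closed form; the arguments are `ℓ_{IJ}, ℓ_{JK}, ℓ_{JI}, ℓ_{IK}, |t|`. -/
def normSqIIa (ij jk ji ik t : ℕ) : ℝ :=
  1 / 2 * (((ij + jk + ji + ik + t + 2 : ℕ) : ℝ) * (ij.factorial : ℝ) * (jk.factorial : ℝ) *
    (ji.factorial : ℝ) * (ik.factorial : ℝ) * (t.factorial : ℝ) *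
    ((ij + ik + t + 1).factorial : ℝ) * ((jk + ji + t + 1).factorial : ℝ) *
    ((ij + jk + ji + ik + t + 1).choose ik : ℝ)) / ((ij + ji + ik + t + 1).choose ik : ℝ)

/-- Class IIb closed form; the arguments are `ℓ_{IJ}, ℓ_{JK}, ℓ_{KJ}, ℓ_{IK}, |t|`. -/
def normSqIIb (ij jk kj ik t : ℕ) : ℝ :=
  1 / 2 * (((ij + jk + kj + ik + t + 2 : ℕ) : ℝ) * (ij.factorial : ℝ) * (jk.factorial : ℝ) *
    (kj.factorial : ℝ) * (ik.factorial : ℝ) * (t.factorial : ℝ) *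
    ((ij + kj + t + 1).factorial : ℝ) * ((jk + ik + t + 1).factorial : ℝ) *
    ((ij + jk + kj + ik + t + 1).choose ik : ℝ)) / ((jk + kj + ik + t + 1).choose ik : ℝ)

/-- `N` is the value of the closed form of a class that `s` belongs to. -/
def IsClosedForm (s : Label) (N : ℝ) : Prop :=
  ∃ I J K : Fin 3,
    (InClassI s I J K ∧
      N = normSqI (s.ell I J) (s.ell J K) (s.ell J I) (s.ell K J) s.absT) ∨
    (InClassIIa s I J K ∧
      N = normSqIIa (s.ell I J) (s.ell J K) (s.ell J I) (s.ell I K) s.absT) ∨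
    (InClassIIb s I J K ∧
      N = normSqIIb (s.ell I J) (s.ell J K) (s.ell K J) (s.ell I K) s.absT)

/-- The ket of `s` divided by the square root of `N`. -/
def unitKet (s : Label) (N : ℝ) : Fock := (((Real.sqrt N)⁻¹ : ℝ) : ℂ) • naiveKet s

/-! ### Checks: adjointness, and the inverse of `P + Q + 1` -/

theorem inner_eq (x y : Fock) : inner ℂ x y = fockInner x y := rfl

theorem fockInner_monomial (m n : Mode →₀ ℕ) (c d : ℂ) :
    fockInner (monomial m c) (monomial n d) =
      if m = n then (starRingEnd ℂ) c * d * (occFactorial m : ℂ) else 0 := by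
  classical
  rw [fockInner_eq_sum _ _ {m} MvPolynomial.support_monomial_subset]
  simp only [Finset.sum_singleton, MvPolynomial.coeff_monomial, if_true]
  by_cases h : m = n
  · simp [h]
  · simp [h, Ne.symm h]

theorem numPQ_monomial (I : Fin 3) (m : Mode →₀ ℕ) (c : ℂ) :
    (numP I + numQ I) (monomial m c) = (legOcc I m : ℂ) • monomial m c := by
  have key : ∀ i : Mode, (X i : Fock) * pderiv i (monomial m c) = (m i : ℂ) • monomial m c := by
    intro i
    rw [X_mul_pderiv_monomial, Nat.cast_smul_eq_nsmul]
  simp only [numP, numQ, aDag, bDag, aAnn, bAnn, LinearMap.add_apply, LinearMap.sum_apply,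
    Module.End.mul_apply, LinearMap.mulLeft_apply, Derivation.coeFn_coe, key, legOcc]
  push_cast
  rw [add_smul, Finset.sum_smul, Finset.sum_smul]

theorem invNum_monomial (I : Fin 3) (m : Mode →₀ ℕ) :
    invNum I (monomial m 1) = ((legOcc I m + 1 : ℕ) : ℂ)⁻¹ • monomial m (1 : ℂ) := by
  have h := (basisMonomials Mode ℂ).constr_basis ℂ
    (fun m => ((legOcc I m + 1 : ℕ) : ℂ)⁻¹ • (monomial m (1 : ℂ) : Fock)) m
  rw [coe_basisMonomials] at h
  exact h

theorem numPQ_one_monomial (I : Fin 3) (m : Mode →₀ ℕ) :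
    (numP I + numQ I + 1) (monomial m 1) = ((legOcc I m + 1 : ℕ) : ℂ) • monomial m (1 : ℂ) := by
  have h : (numP I + numQ I + 1) (monomial m 1) =
      (numP I + numQ I) (monomial m 1) + monomial m 1 := rfl
  rw [h, numPQ_monomial]
  push_cast
  rw [add_smul, one_smul]

/-- `invNum I` is the inverse of `P + Q + 1`. -/
theorem numPQ_mul_invNum (I : Fin 3) : (numP I + numQ I + 1) * invNum I = 1 := by
  refine (basisMonomials Mode ℂ).ext fun m => ?_
  have h : ((legOcc I m + 1 : ℕ) : ℂ) ≠ 0 := by exact_mod_cast Nat.succ_ne_zero (legOcc I m)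
  simp only [coe_basisMonomials]
  rw [Module.End.mul_apply, invNum_monomial, map_smul, numPQ_one_monomial, smul_smul,
    inv_mul_cancel₀ h, one_smul]
  rfl

theorem invNum_mul_numPQ (I : Fin 3) : invNum I * (numP I + numQ I + 1) = 1 := by
  refine (basisMonomials Mode ℂ).ext fun m => ?_
  have h : ((legOcc I m + 1 : ℕ) : ℂ) ≠ 0 := by exact_mod_cast Nat.succ_ne_zero (legOcc I m)
  simp only [coe_basisMonomials]
  rw [Module.End.mul_apply, numPQ_one_monomial, map_smul, invNum_monomial, smul_smul,
    mul_inv_cancel₀ h, one_smul]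
  rfl

theorem occFactorial_add_single (m : Mode →₀ ℕ) (i : Mode) :
    occFactorial (m + Finsupp.single i 1) = (m i + 1) * occFactorial m := by
  classical
  have h1 : ∀ n : Mode →₀ ℕ, n.support ⊆ insert i m.support →
      occFactorial n = ∏ j ∈ insert i m.support, (n j).factorial := fun n hn =>
    Finsupp.prod_of_support_subset n hn _ (by simp)
  have hs : (m + Finsupp.single i 1).support ⊆ insert i m.support := by
    intro j hj
    by_cases hji : j = i
    · simp [hji]
    · simpa [hji] using hj
  rw [h1 _ hs, h1 m (Finset.subset_insert _ _),
    ← Finset.mul_prod_erase _ _ (Finset.mem_insert_self i m.support),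
    ← Finset.mul_prod_erase (insert i m.support) (fun j => (m j).factorial)
      (Finset.mem_insert_self i m.support), ← mul_assoc]
  congr 1
  · simp [Nat.factorial_succ]
  · refine Finset.prod_congr rfl fun j hj => ?_
    have : i ≠ j := (Finset.ne_of_mem_erase hj).symm
    simp [this]

theorem fockInner_add_right (x y z : Fock) :
    fockInner x (y + z) = fockInner x y + fockInner x z := by
  rw [← fockInner_conj_symm, fockInner_add_left, map_add, fockInner_conj_symm,
    fockInner_conj_symm]

/-- Multiplication by a variable and the derivative in it are adjoint to each other. -/
theorem fockInner_X_mul (i : Mode) (x y : Fock) :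
    fockInner (X i * x) y = fockInner x (pderiv i y) := by
  classical
  induction x using MvPolynomial.induction_on' with
  | add p q hp hq => rw [mul_add, fockInner_add_left, hp, hq, fockInner_add_left]
  | monomial m c =>
    induction y using MvPolynomial.induction_on' with
    | add p q hp hq => rw [map_add, fockInner_add_right, hp, hq, fockInner_add_right]
    | monomial n d =>
      have hX : (X i : Fock) * monomial m c = monomial (m + Finsupp.single i 1) c := by
        rw [X, monomial_mul, one_mul, add_comm]
      rw [hX, pderiv_monomial, fockInner_monomial, fockInner_monomial]
      by_cases h : m + Finsupp.single i 1 = n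
      · subst h
        simp [occFactorial_add_single]
        ring
      · rw [if_neg h]
        by_cases h0 : n i = 0
        · simp [h0]
        · rw [if_neg]
          intro hm
          apply h
          rw [hm]
          ext j
          by_cases hj : j = i
          · subst hj
            simp
            omega
          · simp [Ne.symm hj]

theorem norm_vacuum : ‖vacuum‖ = 1 := by
  have h : ‖vacuum‖ ^ 2 = Complex.re (fockInner vacuum vacuum) :=
    norm_sq_eq_re_inner (𝕜 := ℂ) vacuum
  have h2 : fockInner vacuum vacuum = 1 := by
    change fockInner (monomial 0 1) (monomial 0 1) = 1
    rw [fockInner_monomial]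
    simp [occFactorial]
  rw [h2, Complex.one_re] at h
  exact (pow_eq_one_iff_of_nonneg (norm_nonneg vacuum) two_ne_zero).mp h

end LSH

end

/-!
The Fock space is the polynomial ring in the variables `a_I^α`, `b_I^α`, with the inner product for
which multiplication by a variable and differentiation in it are adjoint. A polynomial is *harmonic*
if `∑ α, ∂/∂a_I^α ∂/∂b_I^α` annihilates it for every leg `I`. Harmonic polynomials are orthogonal
to the ideal generated by the leg traces `a_I · b_I`, hence a harmonic polynomial is determined by
its class modulo that ideal. The irreducible Schwinger boson operators preserve harmonicity and act
on these classes as multiplication by `a_I^α` and `b_I^α` (`Rep.irr`). So a naive ket is the unique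
harmonic polynomial congruent to the product of the corresponding powers of `a_I · b_J` and of a
determinant (`rep_naiveKet`); in particular the order of the factors is immaterial, and the quantum
numbers are the degrees of this product.

For the norms, let `h` be the harmonic representative of `f = (a_I · b_J) f'`. Then
`⟪h, h⟫ = ⟪f, h⟫ = ⟪f', D h⟫` with `D = ∑ α, ∂/∂a_I^α ∂/∂b_J^α`, and `D h` is again harmonic. Its
class can be computed from `f` alone: on a leg with `n` quanta, `∂/∂a` acts on classes as
`∂/∂a - (n + 1)⁻¹ b (∂/∂a · ∂/∂b)` (`Harmonic.red_d`). For suitable links of the nondegenerate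
classes the outcome is a multiple `k` of the class of `f'`, so that the squared norms of the
representatives of `f` and `f'` have ratio `k` (`HasNormSq.lower_classI`,
`HasNormSq.lower_classIIa`, `HasNormSq.lower_classIIb`). Removing the links one at a time leaves a
power of the determinant, whose norm is given by Cayley's identity (`cayley`). All of this is done
for both kinds of oscillators at once: for `t < 0` the roles of `a` and `b` are interchanged, which
exchanges the classes IIa and IIb.

Kets of different sectors are orthogonal because their weights differ, and a sector determines `t`
and all the `ℓ_{IJ}` up to adding a constant to `ℓ₁₂, ℓ₂₃, ℓ₃₁` and subtracting it from
`ℓ₂₁, ℓ₃₂, ℓ₁₃`; this yields the classification of the nondegenerate labels.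
-/

noncomputable section

namespace LSH

set_option linter.unusedSimpArgs false

/-! ### Modes, invariants and first-order operators -/

/-- The two kinds of oscillators treated uniformly: `true` stands for `a`, `false` for `b`. -/
def mode (s : Bool) (I α : Fin 3) : Mode := if s then Mode.a I α else Mode.b I α

theorem mode_inj {s s' : Bool} {I I' α α' : Fin 3} :
    mode s I α = mode s' I' α' ↔ s = s' ∧ I = I' ∧ α = α' := by
  cases s <;> cases s' <;> simp [mode]

/-- The variable of a mode; multiplication by it is the creation operator. -/
def u (s : Bool) (I α : Fin 3) : Fock := X (mode s I α)

/-- The derivative in the variable of a mode, its annihilation operator. -/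
def d (s : Bool) (I α : Fin 3) : Derivation ℂ Fock Fock := pderiv (mode s I α)

/-- The contraction of the kind-`s` triplet of leg `I` with the triplet of the opposite kind of
leg `J`: `a_I · b_J` for `s = true` and `b_I · a_J` for `s = false`. -/
def dot (s : Bool) (I J : Fin 3) : Fock := ∑ α, u s I α * u (!s) J α

/-- The determinant of the kind-`s` triplets of the three legs. -/
def det (s : Bool) : Fock :=
  ∑ σ : Equiv.Perm (Fin 3), ((Equiv.Perm.sign σ : ℤ) : ℂ) •
    (u s 0 (σ 0) * u s 1 (σ 1) * u s 2 (σ 2))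

/-- The polarization `∑ α, u_J^α ∂/∂u_I^α`; for `J = I` it is the number operator of a triplet. -/
def pol (s : Bool) (J I : Fin 3) : Derivation ℂ Fock Fock := ∑ α, u s J α • d s I α

/-- The contraction `∑ α, ∂/∂u_I^α ∂/∂v_J^α` of the derivatives of kind `s` on leg `I` with those of
the opposite kind on leg `J`; it is the adjoint of multiplication by `dot s I J`. -/
def con (s : Bool) (I J : Fin 3) : Module.End ℂ Fock :=
  ∑ α, (d s I α).toLinearMap * (d (!s) J α).toLinearMap

theorem pol_apply (s : Bool) (J I : Fin 3) (f : Fock) :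
    pol s J I f = ∑ α, u s J α * d s I α f := by
  have h := congrFun (map_sum (Derivation.coeFnAddMonoidHom (R := ℂ) (A := Fock) (M := Fock))
    (fun α => u s J α • d s I α) Finset.univ) f
  rw [Finset.sum_apply] at h
  exact h

theorem con_apply (s : Bool) (I J : Fin 3) (f : Fock) :
    con s I J f = ∑ α, d s I α (d (!s) J α f) := by
  simp [con, LinearMap.sum_apply]

theorem d_u (s s' : Bool) (I J α β : Fin 3) :
    d s I α (u s' J β) = if s = s' ∧ I = J ∧ α = β then 1 else 0 := by
  simp only [d, u, pderiv_X, Pi.single_apply]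
  congr 1
  rw [mode_inj]
  simp only [eq_comm]

theorem d_comm (s s' : Bool) (I J α β : Fin 3) (f : Fock) :
    d s I α (d s' J β f) = d s' J β (d s I α f) := by
  have h : ⁅d s I α, d s' J β⁆ = 0 := by
    apply MvPolynomial.derivation_ext
    intro i
    simp [Derivation.commutator_apply, d, pderiv_X, Pi.single_apply, apply_ite]
  have := congrArg (fun D : Derivation ℂ Fock Fock => D f) h
  simpa [Derivation.commutator_apply, sub_eq_zero] using this

theorem dot_not (s : Bool) (I J : Fin 3) : dot (!s) I J = dot s J I := by
  simp [dot, mul_comm]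

theorem con_not (s : Bool) (I J : Fin 3) : con (!s) I J = con s J I := by
  refine LinearMap.ext fun f => ?_
  simp only [con_apply, Bool.not_not]
  exact Finset.sum_congr rfl fun α _ => d_comm ..

theorem d_dot (s : Bool) (I J K α : Fin 3) :
    d s I α (dot s J K) = if I = J then u (!s) K α else 0 := by
  by_cases h : I = J <;> simp [dot, d_u, h, Derivation.leibniz]

theorem d_not_dot (s : Bool) (I J K α : Fin 3) :
    d (!s) I α (dot s J K) = if I = K then u s J α else 0 := by
  by_cases h : I = K <;> simp [dot, d_u, h, Derivation.leibniz]

theorem d_not_det (s : Bool) (I α : Fin 3) : d (!s) I α (det s) = 0 := by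
  simp [det, d_u, Derivation.leibniz, map_sum]

/-- The antisymmetrized sum over the permutations of three indices, written out. -/
theorem sum_perm_three {M : Type*} [AddCommGroup M] [Module ℂ M] (G : Fin 3 → Fin 3 → Fin 3 → M) :
    ∑ σ : Equiv.Perm (Fin 3), ((Equiv.Perm.sign σ : ℤ) : ℂ) • G (σ 0) (σ 1) (σ 2) =
      G 0 1 2 - G 0 2 1 - G 1 0 2 + G 1 2 0 + G 2 0 1 - G 2 1 0 := by
  have h : (Finset.univ : Finset (Equiv.Perm (Fin 3))) =
      {1, Equiv.swap 1 2, Equiv.swap 0 1, Equiv.swap 0 1 * Equiv.swap 1 2,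
        Equiv.swap 1 2 * Equiv.swap 0 1, Equiv.swap 0 2} := by decide
  rw [h]
  repeat rw [Finset.sum_insert (by decide)]
  rw [Finset.sum_singleton]
  have e (σ : Equiv.Perm (Fin 3)) (a b c : Fin 3) (ε : ℤ) (h0 : σ 0 = a) (h1 : σ 1 = b)
      (h2 : σ 2 = c) (hs : (Equiv.Perm.sign σ : ℤ) = ε) :
      ((Equiv.Perm.sign σ : ℤ) : ℂ) • G (σ 0) (σ 1) (σ 2) = (ε : ℂ) • G a b c := by
    rw [h0, h1, h2, hs]
  rw [e 1 0 1 2 1 (by decide) (by decide) (by decide) (by decide),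
    e (Equiv.swap 1 2) 0 2 1 (-1) (by decide) (by decide) (by decide) (by decide),
    e (Equiv.swap 0 1) 1 0 2 (-1) (by decide) (by decide) (by decide) (by decide),
    e (Equiv.swap 0 1 * Equiv.swap 1 2) 1 2 0 1 (by decide) (by decide) (by decide) (by decide),
    e (Equiv.swap 1 2 * Equiv.swap 0 1) 2 0 1 1 (by decide) (by decide) (by decide) (by decide),
    e (Equiv.swap 0 2) 2 1 0 (-1) (by decide) (by decide) (by decide) (by decide)]
  push_cast
  module

theorem det_eq (s : Bool) : det s =
    u s 0 0 * u s 1 1 * u s 2 2 - u s 0 0 * u s 1 2 * u s 2 1 - u s 0 1 * u s 1 0 * u s 2 2 +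
      u s 0 1 * u s 1 2 * u s 2 0 + u s 0 2 * u s 1 0 * u s 2 1 - u s 0 2 * u s 1 1 * u s 2 0 :=
  sum_perm_three fun a b c => u s 0 a * u s 1 b * u s 2 c

theorem pol_dot (s : Bool) (M I J K : Fin 3) :
    pol s M I (dot s J K) = if I = J then dot s M K else 0 := by
  rw [pol_apply]
  simp only [d_dot]
  by_cases h : I = J <;> simp [h, dot]

theorem pol_not_dot (s : Bool) (M I J K : Fin 3) :
    pol (!s) M I (dot s J K) = if I = K then dot s J M else 0 := by
  rw [← dot_not, pol_dot, dot_not]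

theorem pol_u (s s' : Bool) (M I J α : Fin 3) :
    pol s M I (u s' J α) = if s = s' ∧ I = J then u s M α else 0 := by
  rw [pol_apply]
  by_cases h : s = s' ∧ I = J
  · obtain ⟨rfl, rfl⟩ := h
    simp [d_u]
  · rw [if_neg h]
    refine Finset.sum_eq_zero fun β _ => ?_
    rw [d_u, if_neg (fun h' => h ⟨h'.1, h'.2.1⟩), mul_zero]

theorem pol_det (s : Bool) (M I : Fin 3) :
    pol s M I (det s) = if M = I then det s else 0 := by
  rw [det_eq]
  simp only [map_sub, map_add, Derivation.leibniz, pol_u, smul_eq_mul, true_and]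
  fin_cases M <;> fin_cases I <;> simp <;> ring

theorem pol_not_det (s : Bool) (M I : Fin 3) : pol (!s) M I (det s) = 0 := by
  simp [pol_apply, d_not_det]

/-! ### Harmonic states and the ideal of the leg traces -/

/-- The ideal generated by the three leg traces `a†(I) · b†(I)`. -/
def traceIdeal : Ideal Fock := Ideal.span (Set.range fun I => dot true I I)

/-- Reduction modulo the leg traces. -/
abbrev red : Fock →+* Fock ⧸ traceIdeal := Ideal.Quotient.mk traceIdeal

/-- A state is harmonic if the annihilator `a(I) · b(I)` kills it for every leg `I`. -/
def Harmonic (f : Fock) : Prop := ∀ I, con true I I f = 0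

theorem dot_self_eq (s s' : Bool) (I : Fin 3) : dot s I I = dot s' I I := by
  obtain rfl | rfl : s = s' ∨ s = !s' := by cases s <;> cases s' <;> simp
  · rfl
  · exact dot_not s' I I

theorem red_dot_self (s : Bool) (I : Fin 3) : red (dot s I I) = 0 := by
  have h : red (dot true I I) = 0 :=
    Ideal.Quotient.eq_zero_iff_mem.mpr (Ideal.subset_span ⟨I, rfl⟩)
  rwa [dot_self_eq s true]

theorem Harmonic.con_eq_zero {f : Fock} (hf : Harmonic f) (s : Bool) (I : Fin 3) :
    con s I I f = 0 := by
  cases s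
  · exact (congrArg (· f) (con_not true I I)).trans (hf I)
  · exact hf I

theorem exists_of_mem_traceIdeal {f : Fock} (hf : f ∈ traceIdeal) :
    ∃ c : Fin 3 → Fock, f = ∑ I, c I * dot true I I := by
  obtain ⟨c, hc⟩ := Ideal.mem_span_range_iff_exists_fun.mp hf
  exact ⟨c, hc.symm⟩

theorem fockInner_u_mul (s : Bool) (I α : Fin 3) (f g : Fock) :
    fockInner (u s I α * f) g = fockInner f (d s I α g) := fockInner_X_mul _ f g

theorem fockInner_sum_left {ι : Type*} (S : Finset ι) (f : ι → Fock) (g : Fock) :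
    fockInner (∑ i ∈ S, f i) g = ∑ i ∈ S, fockInner (f i) g := by
  simp only [← inner_eq, sum_inner]

theorem fockInner_sum_right {ι : Type*} (S : Finset ι) (f : ι → Fock) (g : Fock) :
    fockInner g (∑ i ∈ S, f i) = ∑ i ∈ S, fockInner g (f i) := by
  simp only [← inner_eq, inner_sum]

theorem fockInner_dot_mul (s : Bool) (I J : Fin 3) (f g : Fock) :
    fockInner (dot s I J * f) g = fockInner f (con s I J g) := by
  rw [con_apply, fockInner_sum_right, dot, Finset.sum_mul, fockInner_sum_left]
  refine Finset.sum_congr rfl fun α _ => ?_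
  rw [mul_assoc, fockInner_u_mul, fockInner_u_mul, d_comm]

theorem Harmonic.fockInner_eq_zero {f g : Fock} (hg : Harmonic g) (hf : f ∈ traceIdeal) :
    fockInner f g = 0 := by
  obtain ⟨c, rfl⟩ := exists_of_mem_traceIdeal hf
  rw [fockInner_sum_left]
  refine Finset.sum_eq_zero fun I _ => ?_
  rw [mul_comm, fockInner_dot_mul, hg I, ← inner_eq, inner_zero_right]

theorem Harmonic.fockInner_congr {f f' g : Fock} (hg : Harmonic g) (h : red f = red f') :
    fockInner f g = fockInner f' g := by
  have := hg.fockInner_eq_zero (Ideal.Quotient.eq.mp h)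
  rwa [← inner_eq, inner_sub_left, sub_eq_zero] at this

theorem Harmonic.sub {f g : Fock} (hf : Harmonic f) (hg : Harmonic g) : Harmonic (f - g) :=
  fun I => by rw [map_sub, hf I, hg I, sub_zero]

theorem Harmonic.add {f g : Fock} (hf : Harmonic f) (hg : Harmonic g) : Harmonic (f + g) :=
  fun I => by rw [map_add, hf I, hg I, add_zero]

theorem Harmonic.smul {f : Fock} (hf : Harmonic f) (k : ℂ) : Harmonic (k • f) :=
  fun I => by rw [map_smul, hf I, smul_zero]

theorem con_d (s s' : Bool) (I J K α : Fin 3) (f : Fock) :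
    con s I J (d s' K α f) = d s' K α (con s I J f) := by
  simp only [con_apply, map_sum]
  refine Finset.sum_congr rfl fun β _ => ?_
  rw [d_comm (!s), d_comm s]

theorem Harmonic.d {f : Fock} (hf : Harmonic f) (s : Bool) (I α : Fin 3) :
    Harmonic (d s I α f) := fun J => by rw [con_d, hf J, map_zero]

theorem Harmonic.con {f : Fock} (hf : Harmonic f) (s : Bool) (I J : Fin 3) :
    Harmonic (con s I J f) := fun K => by
  rw [con_apply s I J, map_sum]
  exact Finset.sum_eq_zero fun α _ => ((hf.d _ _ _).d _ _ _) K

/-- Harmonic states are orthogonal to the trace ideal, so a harmonic state is determined by its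
class modulo the leg traces. -/
theorem Harmonic.eq_of_red_eq {f g : Fock} (hf : Harmonic f) (hg : Harmonic g)
    (h : red f = red g) : f = g :=
  sub_eq_zero.mp (fockInner_definite _
    ((hf.sub hg).fockInner_eq_zero (Ideal.Quotient.eq.mp h)))

/-! ### Weights -/

/-- The number operator of all six oscillators of leg `I`. -/
def legNum (I : Fin 3) : Derivation ℂ Fock Fock := pol true I I + pol false I I

theorem legNum_apply (I : Fin 3) (f : Fock) :
    legNum I f = pol true I I f + pol false I I f := rfl

theorem legNum_eq (s : Bool) (I : Fin 3) (f : Fock) :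
    legNum I f = pol s I I f + pol (!s) I I f := by
  cases s
  · exact add_comm _ _
  · rfl

/-- `f` has `w s I` quanta of kind `s` on leg `I`, for all `s` and `I`. The zero polynomial has
every weight. -/
def IsWt (w : Bool → Fin 3 → ℕ) (f : Fock) : Prop := ∀ s I, pol s I I f = (w s I : ℂ) • f

/-- The weight of a single mode. -/
def modeWt (s : Bool) (I : Fin 3) : Bool → Fin 3 → ℕ :=
  fun s' I' => if s = s' ∧ I = I' then 1 else 0

theorem IsWt.mul {w w' : Bool → Fin 3 → ℕ} {f g : Fock} (hf : IsWt w f) (hg : IsWt w' g) :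
    IsWt (w + w') (f * g) := fun s I => by
  rw [Derivation.leibniz, hf, hg, smul_eq_mul, smul_eq_mul, Pi.add_apply, Pi.add_apply]
  push_cast
  simp only [Algebra.smul_def, map_add]
  ring

theorem isWt_one : IsWt 0 1 := fun s I => by simp

theorem IsWt.pow {w : Bool → Fin 3 → ℕ} {f : Fock} (hf : IsWt w f) (n : ℕ) :
    IsWt (n • w) (f ^ n) := by
  induction n with
  | zero => simpa using isWt_one
  | succ n ih => rw [pow_succ, succ_nsmul]; exact ih.mul hf

theorem IsWt.add {w : Bool → Fin 3 → ℕ} {f g : Fock} (hf : IsWt w f) (hg : IsWt w g) :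
    IsWt w (f + g) := fun s I => by rw [map_add, hf, hg, smul_add]

theorem IsWt.smul {w : Bool → Fin 3 → ℕ} {f : Fock} (hf : IsWt w f) (k : ℂ) :
    IsWt w (k • f) := fun s I => by rw [Derivation.map_smul, hf, smul_comm]

theorem isWt_zero (w : Bool → Fin 3 → ℕ) : IsWt w 0 := fun s I => by simp

theorem IsWt.sum {ι : Type*} {w : Bool → Fin 3 → ℕ} {f : ι → Fock} (S : Finset ι)
    (h : ∀ i ∈ S, IsWt w (f i)) : IsWt w (∑ i ∈ S, f i) := fun s I => by
  rw [map_sum, Finset.smul_sum]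
  exact Finset.sum_congr rfl fun i hi => h i hi s I

theorem isWt_u (s : Bool) (I α : Fin 3) : IsWt (modeWt s I) (u s I α) := fun s' I' => by
  rw [pol_u, modeWt]
  by_cases h : s = s' ∧ I = I'
  · simp [h]
  · rw [if_neg h, if_neg (fun h' => h ⟨h'.1.symm, h'.2.symm⟩)]
    simp

theorem isWt_dot (s : Bool) (I J : Fin 3) : IsWt (modeWt s I + modeWt (!s) J) (dot s I J) :=
  IsWt.sum _ fun _ _ => (isWt_u s I _).mul (isWt_u (!s) J _)

theorem IsWt.legNum_eq {w : Bool → Fin 3 → ℕ} {f : Fock} (hf : IsWt w f) (I : Fin 3) :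
    legNum I f = ((w true I + w false I : ℕ) : ℂ) • f := by
  rw [legNum_apply, hf, hf, Nat.cast_add, add_smul]

theorem pol_d (s s' : Bool) (I J α : Fin 3) (f : Fock) :
    pol s I I (d s' J α f) =
      d s' J α (pol s I I f) - if s' = s ∧ J = I then d s' J α f else 0 := by
  rw [pol_apply, pol_apply, map_sum]
  simp only [Derivation.leibniz, d_u, smul_eq_mul, Finset.sum_add_distrib, d_comm s']
  by_cases h : s' = s ∧ J = I
  · obtain ⟨rfl, rfl⟩ := h
    simp
  · have h' : ∀ x, ¬ (s' = s ∧ J = I ∧ α = x) := fun x hx => h ⟨hx.1, hx.2.1⟩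
    simp [h, h']

theorem legNum_d_self (s : Bool) (I α : Fin 3) (f : Fock) :
    legNum I (d s I α f) = d s I α (legNum I f) - d s I α f := by
  rw [legNum_apply, legNum_apply, pol_d, pol_d, map_add]
  cases s <;> simp <;> abel

theorem legNum_d_of_ne {I J : Fin 3} (h : J ≠ I) (s : Bool) (α : Fin 3) (f : Fock) :
    legNum I (d s J α f) = d s J α (legNum I f) := by
  rw [legNum_apply, legNum_apply, pol_d, pol_d, map_add]
  simp [h]

theorem d_dot_mul_self (s : Bool) (I α : Fin 3) (f : Fock) :
    d s I α (dot s I I * f) = u (!s) I α * f + dot s I I * d s I α f := by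
  rw [Derivation.leibniz, d_dot, if_pos rfl, smul_eq_mul, smul_eq_mul]
  ring

theorem d_not_dot_mul_self (s : Bool) (I α : Fin 3) (f : Fock) :
    d (!s) I α (dot s I I * f) = u s I α * f + dot s I I * d (!s) I α f := by
  rw [Derivation.leibniz, d_not_dot, if_pos rfl, smul_eq_mul, smul_eq_mul]
  ring

theorem d_dot_mul_of_ne {I J : Fin 3} (h : I ≠ J) (s s' : Bool) (α : Fin 3) (f : Fock) :
    d s I α (dot s' J J * f) = dot s' J J * d s I α f := by
  rw [Derivation.leibniz]
  obtain rfl | rfl : s' = s ∨ s' = !s := by cases s <;> cases s' <;> simp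
  · rw [d_dot, if_neg h, smul_zero, add_zero, smul_eq_mul]
  · rw [dot_not, d_dot, if_neg h, smul_zero, add_zero, smul_eq_mul]

theorem con_u_mul (s : Bool) (I J α : Fin 3) (f : Fock) :
    con s J J (u s I α * f) =
      (if I = J then d (!s) I α f else 0) + u s I α * con s J J f := by
  simp only [con_apply, Derivation.leibniz, d_u, smul_eq_mul, map_add, Finset.mul_sum,
    Finset.sum_add_distrib]
  by_cases h : I = J
  · subst h
    simp [add_comm]
  · simp [h, Ne.symm h]

theorem con_dot_mul_self (s : Bool) (I : Fin 3) (f : Fock) :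
    con s I I (dot s I I * f) = (3 : ℂ) • f + legNum I f + dot s I I * con s I I f := by
  simp only [con_apply, d_not_dot_mul_self, map_add, d_dot_mul_self, Finset.sum_add_distrib,
    Finset.mul_sum]
  simp only [Derivation.leibniz, d_u, smul_eq_mul, Finset.sum_add_distrib, and_self,
    if_true, mul_one, legNum_eq s, pol_apply, Finset.sum_const, Finset.card_univ, Fintype.card_fin]
  rw [show (3 : ℂ) • f = 3 • f by norm_num [← Nat.cast_smul_eq_nsmul ℂ]]
  abel

theorem con_dot_mul_of_ne {I J : Fin 3} (h : I ≠ J) (s s' : Bool) (f : Fock) :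
    con s I I (dot s' J J * f) = dot s' J J * con s I I f := by
  simp only [con_apply, d_dot_mul_of_ne h, Finset.mul_sum]

/-- The annihilation operator of a mode in a form which descends to the quotient by the leg traces:
`(N + 2) ∂/∂u - v (∂/∂u · ∂/∂v)`, where `u` is the variable of the mode, `v` the variable of the
opposite kind with the same leg and colour, and `N` the number operator of the leg. -/
def low (s : Bool) (I α : Fin 3) (f : Fock) : Fock :=
  legNum I (d s I α f) + (2 : ℂ) • d s I α f - u (!s) I α * con s I I f

theorem low_add (s : Bool) (I α : Fin 3) (f g : Fock) :
    low s I α (f + g) = low s I α f + low s I α g := by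
  simp only [low, map_add, smul_add, mul_add]
  abel

theorem low_dot_mul_mem (s : Bool) (I J α : Fin 3) (f : Fock) :
    low s I α (dot s J J * f) ∈ traceIdeal := by
  rw [← Ideal.Quotient.eq_zero_iff_mem]
  by_cases h : I = J
  · subst h
    have h1 : legNum I (u (!s) I α) = u (!s) I α := by
      cases s <;> simp [legNum_apply, pol_u]
    have h2 : legNum I (dot s I I) = 2 * dot s I I := by
      rw [(isWt_dot s I I).legNum_eq]
      cases s <;> simp [modeWt, Algebra.smul_def] <;> exact Or.inl (map_ofNat C 2)
    have h3 : low s I α (dot s I I * f) = dot s I I *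
        ((4 : ℂ) • d s I α f + legNum I (d s I α f) - u (!s) I α * con s I I f) := by
      rw [low, d_dot_mul_self, con_dot_mul_self]
      simp only [map_add, Derivation.leibniz, h1, h2, smul_eq_mul, Algebra.smul_def,
        map_ofNat]
      ring
    rw [h3]
    change red _ = 0
    rw [map_mul, red_dot_self, zero_mul]
  · have h2 : legNum I (dot s J J) = 0 := by
      rw [(isWt_dot s J J).legNum_eq]
      cases s <;> simp [modeWt, Ne.symm h]
    have h3 : low s I α (dot s J J * f) = dot s J J * low s I α f := by
      rw [low, low, d_dot_mul_of_ne h, con_dot_mul_of_ne h]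
      simp only [Derivation.leibniz, h2, smul_eq_mul, Algebra.smul_def]
      ring
    rw [h3]
    change red _ = 0
    rw [map_mul, red_dot_self, zero_mul]

/-- `low` is well defined on classes modulo the leg traces. No homogeneity is needed, since its
coefficient is the number operator rather than a number. -/
theorem red_low_congr {f g : Fock} (h : red f = red g) (s : Bool) (I α : Fin 3) :
    red (low s I α f) = red (low s I α g) := by
  obtain ⟨c, hc⟩ := exists_of_mem_traceIdeal (Ideal.Quotient.eq.mp h)
  have hsum : ∀ S : Finset (Fin 3),
      red (low s I α (g + ∑ J ∈ S, c J * dot true J J)) = red (low s I α g) := by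
    intro S
    induction S using Finset.induction_on with
    | empty => simp
    | insert J S hJ ih =>
      rw [Finset.sum_insert hJ, add_left_comm, low_add, map_add, ih, add_eq_right]
      refine Ideal.Quotient.eq_zero_iff_mem.mpr ?_
      rw [mul_comm, dot_self_eq true s]
      exact low_dot_mul_mem s I J α (c J)
  -- all three generators at once
  rw [← hsum Finset.univ, ← hc, add_sub_cancel]

/-- The value of the descended annihilation operator on states with `n` quanta on leg `I`. -/
theorem low_eq {f : Fock} {n : ℂ} {I : Fin 3} (hf : legNum I f = n • f) (s : Bool) (α : Fin 3) :
    low s I α f = (n + 1) • d s I α f - u (!s) I α * con s I I f := by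
  rw [low, legNum_d_self, hf, Derivation.map_smul]
  module

/-- On a leg with `n` quanta, differentiating the harmonic representative `h` of `f` amounts to
applying `∂/∂u - (n + 1)⁻¹ v (∂/∂u · ∂/∂v)` to `f`. -/
theorem Harmonic.red_d {f h : Fock} (hh : Harmonic h) (hfh : red f = red h) {n : ℕ} {I : Fin 3}
    (hf : legNum I f = (n : ℂ) • f) (hn : legNum I h = (n : ℂ) • h) (s : Bool) (α : Fin 3) :
    red (LSH.d s I α h) =
      red (LSH.d s I α f - ((n : ℂ) + 1)⁻¹ • (u (!s) I α * LSH.con s I I f)) := by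
  have h0 : (n : ℂ) + 1 ≠ 0 := Nat.cast_add_one_ne_zero n
  have key := red_low_congr hfh s I α
  rw [low_eq hf, low_eq hn, hh.con_eq_zero, mul_zero, sub_zero] at key
  have e1 : LSH.d s I α h = ((n : ℂ) + 1)⁻¹ • (((n : ℂ) + 1) • LSH.d s I α h) := by
    rw [smul_smul, inv_mul_cancel₀ h0, one_smul]
  have e2 : LSH.d s I α f - ((n : ℂ) + 1)⁻¹ • (u (!s) I α * LSH.con s I I f) =
      ((n : ℂ) + 1)⁻¹ • (((n : ℂ) + 1) • LSH.d s I α f - u (!s) I α * LSH.con s I I f) := by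
    rw [smul_sub, smul_smul, inv_mul_cancel₀ h0, one_smul]
  rw [e1, e2, Algebra.smul_def, Algebra.smul_def _ (_ - _), map_mul, map_mul, key]

/-! ### Irreducible Schwinger bosons acting on harmonic states -/

/-- `h` is the harmonic representative of the polynomial `f` modulo the leg traces, and both have
weight `w`. -/
structure Rep (w : Bool → Fin 3 → ℕ) (f h : Fock) : Prop where
  wt : IsWt w f
  wt' : IsWt w h
  harmonic : Harmonic h
  red_eq : red f = red h

/-- The irreducible Schwinger boson creation operator of a mode. -/
def irr (s : Bool) (I α : Fin 3) : Module.End ℂ Fock := if s then ADag I α else BDag I α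

theorem numP_apply (I : Fin 3) (f : Fock) : numP I f = pol true I I f := by
  simp [numP, pol_apply, aDag, aAnn, u, d, mode, LinearMap.sum_apply]

theorem numQ_apply (I : Fin 3) (f : Fock) : numQ I f = pol false I I f := by
  simp [numQ, pol_apply, bDag, bAnn, u, d, mode, LinearMap.sum_apply]

theorem abDag_apply (I : Fin 3) (f : Fock) : abDag I f = dot true I I * f := by
  simp [abDag, dot, aDag, bDag, u, mode, LinearMap.sum_apply, Finset.sum_mul, mul_assoc]

theorem invNum_apply_of_legNum {I : Fin 3} {f : Fock} {n : ℕ} (hf : legNum I f = (n : ℂ) • f) :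
    invNum I f = ((n : ℂ) + 1)⁻¹ • f := by
  have h0 : (n : ℂ) + 1 ≠ 0 := Nat.cast_add_one_ne_zero n
  have h1 : (numP I + numQ I + 1) f = ((n : ℂ) + 1) • f := by
    rw [LinearMap.add_apply, LinearMap.add_apply, numP_apply, numQ_apply, ← legNum_apply, hf,
      Module.End.one_apply, add_smul, one_smul]
  have h2 := LinearMap.congr_fun (invNum_mul_numPQ I) f
  rw [Module.End.mul_apply, h1, map_smul, Module.End.one_apply] at h2
  rw [← h2, smul_smul, inv_mul_cancel₀ h0, one_smul, h2]

theorem irr_apply (s : Bool) (I α : Fin 3) (f : Fock) :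
    irr s I α f = u s I α * f - invNum I (dot s I I * d (!s) I α f) := by
  rw [dot_self_eq s true]
  cases s
  · have e : irr false I α = bDag I α - invNum I * abDag I * aAnn I α := rfl
    have e1 : bDag I α f = u false I α * f := rfl
    have e2 : aAnn I α f = d (!false) I α f := rfl
    rw [e, LinearMap.sub_apply, Module.End.mul_apply, Module.End.mul_apply, abDag_apply, e1, e2]
  · have e : irr true I α = aDag I α - invNum I * abDag I * bAnn I α := rfl
    have e1 : aDag I α f = u true I α * f := rfl
    have e2 : bAnn I α f = d (!true) I α f := rfl
    rw [e, LinearMap.sub_apply, Module.End.mul_apply, Module.End.mul_apply, abDag_apply, e1, e2]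

/-- The correction term of an irreducible Schwinger boson has the same weight as the main term. -/
theorem IsWt.dot_mul_d {w : Bool → Fin 3 → ℕ} {f : Fock} (hf : IsWt w f) (s : Bool)
    (I α : Fin 3) : IsWt (modeWt s I + w) (dot s I I * d (!s) I α f) := fun s' I' => by
  rw [Derivation.leibniz, isWt_dot, pol_d, hf, Derivation.map_smul]
  by_cases h : I = I'
  · subst h
    cases s <;> cases s' <;> simp [modeWt, Algebra.smul_def] <;> ring
  · simp [modeWt, h, Algebra.smul_def]
    ring

theorem irr_apply_of_isWt {w : Bool → Fin 3 → ℕ} {f : Fock} (hf : IsWt w f) (s : Bool)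
    (I α : Fin 3) : irr s I α f = u s I α * f -
      (((w true I + w false I + 1 : ℕ) : ℂ) + 1)⁻¹ • (dot s I I * d (!s) I α f) := by
  rw [irr_apply, invNum_apply_of_legNum]
  rw [(hf.dot_mul_d s I α).legNum_eq]
  cases s <;> simp [modeWt] <;> congr 1 <;> ring

/-- The irreducible Schwinger boson operators preserve harmonicity and act modulo the leg traces
as multiplication by the corresponding variable. -/
theorem Rep.irr {w : Bool → Fin 3 → ℕ} {f h : Fock} (hr : Rep w f h) (s : Bool) (I α : Fin 3) :
    Rep (modeWt s I + w) (u s I α * f) (irr s I α h) := by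
  have hirr := irr_apply_of_isWt hr.wt' s I α
  refine ⟨(isWt_u s I α).mul hr.wt, ?_, fun J => ?_, ?_⟩
  · rw [hirr, sub_eq_add_neg, ← neg_smul]
    exact ((isWt_u s I α).mul hr.wt').add ((hr.wt'.dot_mul_d s I α).smul _)
  · suffices con s J J (LSH.irr s I α h) = 0 by
      cases s
      · rwa [← con_not] at this
      · exact this
    rw [hirr, map_sub, map_smul, con_u_mul, hr.harmonic.con_eq_zero, mul_zero, add_zero]
    by_cases hIJ : I = J
    · subst hIJ
      have h0 : (((w true I + w false I + 1 : ℕ) : ℂ) + 1) ≠ 0 := Nat.cast_add_one_ne_zero _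
      rw [if_pos rfl, con_dot_mul_self, legNum_d_self, hr.wt'.legNum_eq, Derivation.map_smul,
        (hr.harmonic.d _ _ _).con_eq_zero, mul_zero, add_zero]
      -- the commutator of the contraction with the trace is `N + 3`, which is `n + 2` on `∂h/∂v`
      have e : (3 : ℂ) • d (!s) I α h + (((w true I + w false I : ℕ) : ℂ) • d (!s) I α h -
          d (!s) I α h) = (((w true I + w false I + 1 : ℕ) : ℂ) + 1) • d (!s) I α h := by
        push_cast
        module
      rw [e, smul_smul, inv_mul_cancel₀ h0, one_smul, sub_self]
    · rw [if_neg hIJ, con_dot_mul_of_ne (Ne.symm hIJ), (hr.harmonic.d _ _ _).con_eq_zero,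
        mul_zero, smul_zero, sub_zero]
  · rw [hirr, map_sub, map_mul, map_mul, hr.red_eq, Algebra.smul_def, map_mul, map_mul,
      red_dot_self, zero_mul, mul_zero, sub_zero]

theorem Rep.add {w : Bool → Fin 3 → ℕ} {f f' h h' : Fock} (hr : Rep w f h) (hr' : Rep w f' h') :
    Rep w (f + f') (h + h') :=
  ⟨hr.wt.add hr'.wt, hr.wt'.add hr'.wt', hr.harmonic.add hr'.harmonic, by
    rw [map_add, map_add, hr.red_eq, hr'.red_eq]⟩

theorem Rep.smul {w : Bool → Fin 3 → ℕ} {f h : Fock} (hr : Rep w f h) (k : ℂ) :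
    Rep w (k • f) (k • h) :=
  ⟨hr.wt.smul k, hr.wt'.smul k, hr.harmonic.smul k, by
    rw [Algebra.smul_def, Algebra.smul_def, map_mul, map_mul, hr.red_eq]⟩

theorem rep_zero (w : Bool → Fin 3 → ℕ) : Rep w 0 0 :=
  ⟨isWt_zero w, isWt_zero w, fun _ => map_zero _, rfl⟩

theorem Rep.sum {ι : Type*} {w : Bool → Fin 3 → ℕ} {f h : ι → Fock} (S : Finset ι)
    (hr : ∀ i ∈ S, Rep w (f i) (h i)) : Rep w (∑ i ∈ S, f i) (∑ i ∈ S, h i) := by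
  classical
  induction S using Finset.induction_on with
  | empty => simpa using rep_zero w
  | insert i S hi ih =>
    rw [Finset.sum_insert hi, Finset.sum_insert hi]
    exact (hr i (by simp)).add (ih fun j hj => hr j (by simp [hj]))

theorem Rep.congr_wt {w w' : Bool → Fin 3 → ℕ} {f h : Fock} (hr : Rep w f h) (hw : w = w') :
    Rep w' f h := hw ▸ hr

/-- The operator `L†_{IJ}` for `s = true`, and `L†_{JI}` with the factors interchanged for
`s = false`. -/
def link (s : Bool) (I J : Fin 3) : Module.End ℂ Fock := ∑ α, irr s I α * irr (!s) J α

/-- `T_A†` for `s = true` and `T_B†` for `s = false`. -/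
def tri (s : Bool) : Module.End ℂ Fock :=
  ∑ σ : Equiv.Perm (Fin 3), ((Equiv.Perm.sign σ : ℤ) : ℂ) •
    (irr s 0 (σ 0) * irr s 1 (σ 1) * irr s 2 (σ 2))

/-- The weight of `dot s I J`. -/
def linkWt (s : Bool) (I J : Fin 3) : Bool → Fin 3 → ℕ := modeWt s I + modeWt (!s) J

/-- The weight of `det s`. -/
def triWt (s : Bool) : Bool → Fin 3 → ℕ := modeWt s 0 + modeWt s 1 + modeWt s 2

theorem Rep.link {w : Bool → Fin 3 → ℕ} {f h : Fock} (hr : Rep w f h) (s : Bool) (I J : Fin 3) :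
    Rep (linkWt s I J + w) (dot s I J * f) (link s I J h) := by
  rw [dot, Finset.sum_mul, LSH.link, LinearMap.sum_apply]
  refine Rep.sum _ fun α _ => ?_
  rw [mul_assoc, linkWt, add_assoc]
  exact (hr.irr (!s) J α).irr s I α

theorem Rep.tri {w : Bool → Fin 3 → ℕ} {f h : Fock} (hr : Rep w f h) (s : Bool) :
    Rep (triWt s + w) (det s * f) (tri s h) := by
  rw [det, Finset.sum_mul, LSH.tri, LinearMap.sum_apply]
  refine Rep.sum _ fun σ _ => ?_
  rw [smul_mul_assoc, LinearMap.smul_apply, mul_assoc, mul_assoc, triWt, add_assoc, add_assoc]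
  exact (((hr.irr s 2 _).irr s 1 _).irr s 0 _).smul _

theorem Rep.link_pow {w : Bool → Fin 3 → ℕ} {f h : Fock} (hr : Rep w f h) (s : Bool)
    (I J : Fin 3) (n : ℕ) :
    Rep (n • linkWt s I J + w) (dot s I J ^ n * f) ((LSH.link s I J ^ n) h) := by
  induction n with
  | zero => simpa using hr
  | succ n ih =>
    rw [pow_succ' (dot s I J), mul_assoc, succ_nsmul', add_assoc, pow_succ' (LSH.link s I J)]
    exact ih.link s I J

theorem Rep.tri_pow {w : Bool → Fin 3 → ℕ} {f h : Fock} (hr : Rep w f h) (s : Bool) (n : ℕ) :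
    Rep (n • triWt s + w) (det s ^ n * f) ((LSH.tri s ^ n) h) := by
  induction n with
  | zero => simpa using hr
  | succ n ih =>
    rw [pow_succ' (det s), mul_assoc, succ_nsmul', add_assoc, pow_succ' (LSH.tri s)]
    exact ih.tri s

theorem rep_vacuum : Rep 0 1 vacuum :=
  ⟨isWt_one, isWt_one, fun I => by simp [con_apply, vacuum], rfl⟩

theorem tri_true : tri true = TADag := rfl

theorem tri_false : tri false = TBDag := rfl

/-! ### Norms of harmonic representatives -/

/-- The harmonic representative of `f` exists and has squared norm `c`. -/
def HasNormSq (f : Fock) (c : ℂ) : Prop :=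
  ∃ h, Harmonic h ∧ red f = red h ∧ fockInner h h = c

theorem HasNormSq.of_rep {w : Bool → Fin 3 → ℕ} {f h : Fock} {c : ℂ} (hf : HasNormSq f c)
    (hr : Rep w f h) : fockInner h h = c := by
  obtain ⟨h', hh', hred, rfl⟩ := hf
  rw [hr.harmonic.eq_of_red_eq hh' (hr.red_eq.symm.trans hred)]

/-- Lowering step: if the adjoint of `dot s I J` sends the harmonic representative of
`dot s I J * f` to `k` times that of `f`, the squared norms of the two differ by the factor `k`. -/
theorem HasNormSq.dot_mul {f h : Fock} {c k : ℂ} {s : Bool} {I J : Fin 3} (hf : HasNormSq f c)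
    (hh : Harmonic h) (hred : red (dot s I J * f) = red h)
    (hcon : red (con s I J h) = red (k • f)) : HasNormSq (dot s I J * f) (k * c) := by
  obtain ⟨h', hh', hred', rfl⟩ := hf
  refine ⟨h, hh, hred, ?_⟩
  have e : con s I J h = k • h' := (hh.con s I J).eq_of_red_eq (hh'.smul k) (by
    rw [hcon, Algebra.smul_def, Algebra.smul_def, map_mul, map_mul, hred'])
  rw [← hh.fockInner_congr hred, fockInner_dot_mul, e, ← inner_eq, ← inner_eq, inner_smul_right,
    inner_eq, hh'.fockInner_congr hred', inner_eq]

/-! ### Lowering a link -/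

theorem red_smul (k : ℂ) (f : Fock) : red (k • f) = k • red f := rfl

/-- The formal derivative `n L ^ (n - 1)` of `L ^ n`. At `n = 0` it vanishes, whatever the truncated
exponent, so that no positivity of `n` is needed in `mul_dpow`. -/
def dpow (L : Fock) (n : ℕ) : Fock := (n : ℂ) • L ^ (n - 1)

theorem dpow_succ (L : Fock) (n : ℕ) : dpow L (n + 1) = ((n : ℂ) + 1) • L ^ n := by
  simp [dpow]

theorem mul_dpow (L : Fock) (n : ℕ) : L * dpow L n = (n : ℂ) • L ^ n := by
  cases n with
  | zero => simp [dpow]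
  | succ n => rw [dpow_succ, mul_smul_comm, pow_succ']; push_cast; rfl

theorem derivation_pow (D : Derivation ℂ Fock Fock) (L : Fock) (n : ℕ) :
    D (L ^ n) = dpow L n * D L := by
  rw [Derivation.leibniz_pow, dpow, ← Nat.cast_smul_eq_nsmul ℂ, smul_mul_assoc, smul_eq_mul]

theorem derivation_mul (D : Derivation ℂ Fock Fock) (f g : Fock) :
    D (f * g) = f * D g + g * D f := D.leibniz f g

theorem derivation_dpow_eq_zero {D : Derivation ℂ Fock Fock} {L : Fock} (h : D L = 0) (n : ℕ) :
    D (dpow L n) = 0 := by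
  rw [dpow, Derivation.map_smul, derivation_pow, h, mul_zero, smul_zero]

/-- `D f = n f`. The eigenvalue is complex so that `n - 1` makes sense for `dpow`. -/
def Eig (D : Derivation ℂ Fock Fock) (f : Fock) (n : ℂ) : Prop := D f = n • f

theorem Eig.mul {D : Derivation ℂ Fock Fock} {f g : Fock} {m n : ℂ} (hf : Eig D f m)
    (hg : Eig D g n) : Eig D (f * g) (m + n) := by
  rw [Eig, derivation_mul, hf, hg, mul_smul_comm, mul_smul_comm, mul_comm g, add_smul, add_comm]

theorem Eig.pow {D : Derivation ℂ Fock Fock} {f : Fock} {n : ℂ} (hf : Eig D f n) (k : ℕ) :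
    Eig D (f ^ k) (k * n) := by
  rw [Eig, derivation_pow, hf, mul_smul_comm, mul_comm, mul_dpow, smul_smul, mul_comm]

theorem Eig.dpow {D : Derivation ℂ Fock Fock} {f : Fock} {n : ℂ} (hf : Eig D f n) (k : ℕ) :
    Eig D (dpow f k) ((k - 1) * n) := by
  cases k with
  | zero => simp [LSH.dpow, Eig]
  | succ k =>
    rw [dpow_succ, Eig, Derivation.map_smul, hf.pow k, smul_comm]
    push_cast
    rw [add_sub_cancel_right]

theorem Eig.smul {D : Derivation ℂ Fock Fock} {f : Fock} {n : ℂ} (hf : Eig D f n) (k : ℂ) :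
    Eig D (k • f) n := by
  rw [Eig, Derivation.map_smul, hf, smul_comm]

theorem eig_zero (D : Derivation ℂ Fock Fock) (n : ℂ) : Eig D 0 n := by simp [Eig]

theorem eig_pol_dot (s : Bool) (A I J : Fin 3) :
    Eig (pol s A A) (dot s I J) (if A = I then 1 else 0) := by
  rw [Eig, pol_dot]
  split_ifs with h <;> simp [h]

theorem eig_pol_not_dot (s : Bool) (A I J : Fin 3) :
    Eig (pol (!s) A A) (dot s I J) (if A = J then 1 else 0) := by
  rw [Eig, pol_not_dot]
  split_ifs with h <;> simp [h]

theorem eig_pol_det (s : Bool) (A : Fin 3) : Eig (pol s A A) (det s) 1 := by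
  simp [Eig, pol_det]

theorem eig_pol_not_det (s : Bool) (A : Fin 3) : Eig (pol (!s) A A) (det s) 0 := by
  simp [Eig, pol_not_det]

theorem eig_legNum_dot (s : Bool) (A I J : Fin 3) :
    Eig (legNum A) (dot s I J) ((if A = I then 1 else 0) + if A = J then 1 else 0) := by
  rw [Eig, legNum_eq s, eig_pol_dot, eig_pol_not_dot, add_smul]

theorem eig_legNum_det (s : Bool) (A : Fin 3) : Eig (legNum A) (det s) 1 := by
  rw [Eig, legNum_eq s, eig_pol_det, eig_pol_not_det, zero_smul, add_zero]

theorem eig_legNum_u (s : Bool) (A I α : Fin 3) :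
    Eig (legNum A) (u s I α) (if A = I then 1 else 0) := by
  rw [Eig, legNum_eq s, pol_u, pol_u]
  by_cases h : A = I <;> cases s <;> simp [h]

theorem Eig.add {D : Derivation ℂ Fock Fock} {f g : Fock} {n : ℂ} (hf : Eig D f n)
    (hg : Eig D g n) : Eig D (f + g) n := by
  rw [Eig, map_add, hf, hg, smul_add]

theorem Eig.congr {D : Derivation ℂ Fock Fock} {f : Fock} {m n : ℂ} (hf : Eig D f m)
    (h : m = n) : Eig D f n := h ▸ hf

theorem con_not_self (s : Bool) (I : Fin 3) : con (!s) I I = con s I I := con_not s I I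

/-- The adjoint of a link acts on a harmonic representative one leg at a time, each time by the
descended annihilation operator. -/
theorem Rep.red_con {w : Bool → Fin 3 → ℕ} {f h : Fock} (hr : Rep w f h) {s : Bool} {A B : Fin 3}
    (hBA : B ≠ A) {m n : ℕ} (hm : w true A + w false A = m) (hn : w true B + w false B = n)
    {g : Fin 3 → Fock} (hg : ∀ α, Eig (legNum A) (g α) m)
    (hgf : ∀ α, red (g α) =
      red (d (!s) B α f - ((n : ℂ) + 1)⁻¹ • (u s B α * con s B B f))) :
    red (con s A B h) = red (∑ α, (d s A α (g α) -
      ((m : ℂ) + 1)⁻¹ • (u (!s) A α * con s A A (g α)))) := by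
  subst hm hn
  rw [con_apply, map_sum, map_sum]
  refine Finset.sum_congr rfl fun α _ => ?_
  have h1 := hr.harmonic.red_d hr.red_eq (hr.wt.legNum_eq B) (hr.wt'.legNum_eq B) (!s) α
  rw [Bool.not_not, con_not_self, ← hgf] at h1
  refine (hr.harmonic.d (!s) B α).red_d h1.symm (hg α) ?_ s α
  rw [legNum_d_of_ne hBA, hr.wt'.legNum_eq, Derivation.map_smul]

/-- The commutator of `∂/∂u_A` and `u_P` contributes the number of colours if `P = A`. -/
theorem sum_d_u_mul (s : Bool) (A P : Fin 3) (f : Fock) :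
    ∑ α, d s A α (u s P α * f) = (if A = P then (3 : ℂ) • f else 0) + pol s P A f := by
  rw [pol_apply]
  simp only [derivation_mul, d_u, Finset.sum_add_distrib]
  rw [add_comm]
  by_cases h : A = P
  · simp [h, Algebra.smul_def]
    left
    exact (map_ofNat C 3).symm
  · simp [h]

theorem con_eq_of_d {s : Bool} {A B P : Fin 3} (hA : B ≠ A) (hP : B ≠ P) {f F G : Fock}
    (hF : ∀ α, d (!s) B α f = u s A α * F + u s P α * G) :
    con s B B f = pol s A B F + pol s P B G := by
  rw [con_apply]
  simp only [hF, map_add, Finset.sum_add_distrib, sum_d_u_mul, if_neg hA, if_neg hP, zero_add]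

theorem sum_u_not_con_u (s : Bool) (A P : Fin 3) (f : Fock) :
    ∑ α, u (!s) A α * con s A A (u s P α * f) =
      (if P = A then pol (!s) A A f else 0) + dot s P A * con s A A f := by
  simp only [con_u_mul, mul_add, Finset.sum_add_distrib]
  congr 1
  · split_ifs with h
    · subst h
      rw [pol_apply]
    · simp
  · rw [dot, Finset.sum_mul]
    exact Finset.sum_congr rfl fun α _ => by ring

/-- The adjoint of the link `(A, B)` on the harmonic representative of a state `f` whose derivative
in the opposite triplet of `B` is `u_A F + u_P G`. The descended derivative is then congruent to
`u_A F + u_P G + u_B H`, where `H` comes from the contraction on leg `B`; any homogeneous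
representative of it may be used. The numbers `p` and `q` count the quanta of the two kinds on leg
`A` of the state `f'` that remains after the link is removed. -/
theorem Rep.red_con_eq {w : Bool → Fin 3 → ℕ} {f h : Fock} (hr : Rep w f h) {s : Bool}
    {A B P : Fin 3} (hL : AreLegs A B P) {m n : ℕ}
    (hm : w true A + w false A = m + 1) (hn : w true B + w false B = n)
    {F G H : Fock} {k p q : ℂ} {f' : Fock} (hFf : F = k • f')
    (hF : ∀ α, d (!s) B α f = u s A α * F + u s P α * G)
    (hH : red H = red (-((n : ℂ) + 1)⁻¹ • (pol s A B F + pol s P B G)))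
    (hp : Eig (pol s A A) f' p) (hq : Eig (pol (!s) A A) f' q) (hpq : p + q = m)
    (hG : Eig (legNum A) G (m + 1))
    (hH' : Eig (legNum A) H (m + 1)) :
    red (con s A B h) = (k * (3 + p - ((m : ℂ) + 2)⁻¹ * q)) • red f' +
      red (pol s P A G) + red (pol s B A H) -
      ((m : ℂ) + 2)⁻¹ • (red (dot s P A * con s A A G) + red (dot s B A * con s A A H)) := by
  obtain ⟨hAB, hBP, hPA⟩ := hL
  have hp' : pol s A A f' = p • f' := hp
  have hq' : pol (!s) A A f' = q • f' := hq
  have hf' : Eig (legNum A) f' m := by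
    rw [Eig, LSH.legNum_eq s, hp, hq, ← add_smul, hpq]
  rw [hr.red_con (m := m + 1) (g := fun α => u s A α * F + u s P α * G + u s B α * H)
    (Ne.symm hAB) hm hn]
  · have e : ((m + 1 : ℕ) : ℂ) + 1 = m + 2 := by push_cast; ring
    rw [e, Finset.sum_sub_distrib, ← Finset.smul_sum]
    simp only [map_add, mul_add, Finset.sum_add_distrib, sum_d_u_mul, sum_u_not_con_u, if_pos,
      if_neg hAB, if_neg hPA, if_neg (Ne.symm hPA), if_neg (Ne.symm hAB)]
    simp only [map_add, map_sub, red_smul, map_mul, red_dot_self, zero_mul, hFf,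
      Derivation.map_smul, hp', hq', map_zero]
    module
  · intro α
    rw [hFf]
    refine Eig.add (Eig.add ?_ ?_) ?_
    · exact ((eig_legNum_u s A A α).mul (hf'.smul k)).congr (by simp; ring)
    · exact ((eig_legNum_u s A P α).mul hG).congr (by simp [Ne.symm hPA])
    · exact ((eig_legNum_u s A B α).mul hH').congr (by simp [hAB])
  · intro α
    rw [con_eq_of_d (Ne.symm hAB) hBP hF, hF]
    simp only [map_add, map_sub, map_mul, hH, Algebra.smul_def, map_neg]
    ring

theorem rep_det_pow (s : Bool) (t : ℕ) : Rep (t • triWt s) (det s ^ t) ((tri s ^ t) vacuum) := by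
  simpa using rep_vacuum.tri_pow s t

/-! ### The lowering steps for the three classes -/

theorem HasNormSq.congr {f : Fock} {c c' : ℂ} (hf : HasNormSq f c) (h : c = c') :
    HasNormSq f c' := h ▸ hf

theorem natCast_add_two_ne_zero (n : ℕ) : (n : ℂ) + 2 ≠ 0 := by
  exact_mod_cast Nat.succ_ne_zero (n + 1)

theorem triWt_apply (s s' : Bool) (I : Fin 3) : triWt s s' I = if s = s' then 1 else 0 := by
  fin_cases I <;> simp [triWt, modeWt]

/-- Removal of one link `(J, I)` in the presence of the links `(I, J)`, `(J, K)`, `(K, J)`. The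
opposite triplet of leg `I` occurs in no other link, and the contraction on leg `I` produces only
the trace of leg `J`, so that neither `G` nor `H` of `Rep.red_con_eq` contributes. -/
theorem HasNormSq.lower_classI {I J K : Fin 3} (hL : AreLegs I J K) (s : Bool)
    (x y z w t : ℕ) {c : ℂ}
    (hf : HasNormSq (dot s J I ^ z * (dot s I J ^ x * (dot s J K ^ y * (dot s K J ^ w *
      det s ^ t)))) c) :
    HasNormSq (dot s J I ^ (z + 1) * (dot s I J ^ x * (dot s J K ^ y * (dot s K J ^ w *
      det s ^ t))))
      (((z : ℂ) + 1) * (z + y + t + 2) * (x + y + z + w + t + 3) / (x + y + z + w + t + 2) *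
        c) := by
  obtain ⟨hIJ, hJK, hKI⟩ := hL
  have hr := ((((rep_det_pow s t).link_pow s K J w).link_pow s J K y).link_pow s I J
    x).link_pow s J I (z + 1)
  rw [pow_succ', mul_assoc] at hr ⊢
  refine hf.dot_mul hr.harmonic hr.red_eq ?_
  rw [← mul_assoc, ← pow_succ'] at hr
  rw [hr.red_con_eq (P := K) (m := z + y + t + x + w) (n := z + 1 + x + t)
    (F := ((z : ℂ) + 1) • (dot s J I ^ z * (dot s I J ^ x * (dot s J K ^ y * (dot s K J ^ w *
      det s ^ t))))) (G := 0) (H := 0) (k := (z : ℂ) + 1) (p := z + y + t) (q := x + w)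
    ⟨hIJ.symm, hKI.symm, hJK.symm⟩ ?_ ?_ rfl ?_ ?_ ?_ ?_ ?_ (eig_zero _ _) (eig_zero _ _)]
  · simp only [map_zero, mul_zero, add_zero, sub_zero, smul_zero]
    rw [← red_smul]
    congr 2
    have h1 := natCast_add_two_ne_zero (z + y + t + x + w)
    have h2 := natCast_add_two_ne_zero (x + y + z + w + t)
    push_cast at h1 h2 ⊢
    field_simp
    ring
  · fin_cases s <;> simp [linkWt, triWt_apply, modeWt, hIJ, hJK, hKI, hIJ.symm, hJK.symm,
      hKI.symm] <;> omega
  · fin_cases s <;> simp [linkWt, triWt_apply, modeWt, hIJ, hJK, hKI, hIJ.symm, hJK.symm,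
      hKI.symm] <;> omega
  · intro α
    simp only [derivation_mul, derivation_pow, d_not_dot, d_not_det, hIJ, hJK, hKI, hIJ.symm,
      hJK.symm, hKI.symm, dpow_succ, if_true, if_false, mul_zero, add_zero, Algebra.smul_def]
    ring
  · simp [derivation_mul, derivation_pow, pol_dot, pol_det, hIJ, hJK, hKI, hIJ.symm,
      hJK.symm, hKI.symm, red_dot_self, red_smul]
  · refine Eig.congr (((eig_pol_dot ..).pow z).mul (((eig_pol_dot ..).pow x).mul
      (((eig_pol_dot ..).pow y).mul (((eig_pol_dot ..).pow w).mul
      ((eig_pol_det ..).pow t))))) ?_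
    simp [hIJ, hJK, hKI, hIJ.symm, hJK.symm, hKI.symm]
    ring
  · refine Eig.congr (((eig_pol_not_dot ..).pow z).mul (((eig_pol_not_dot ..).pow x).mul
      (((eig_pol_not_dot ..).pow y).mul (((eig_pol_not_dot ..).pow w).mul
      ((eig_pol_not_det ..).pow t))))) ?_
    simp [hIJ, hJK, hKI, hIJ.symm, hJK.symm, hKI.symm]
  · push_cast
    ring

/-- Removal of one link `(I, J)` in the presence of the links `(J, K)`, `(K, J)`, `(I, K)`. The
opposite triplet of leg `J` also occurs in the links `(K, J)`, which gives the state `G` of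
`Rep.red_con_eq`; the contraction on leg `J` turns a pair of links `(I, J)`, `(J, K)` into a link
`(I, K)`, which gives `H`. The opposite triplet of leg `I` does not occur at all, so that there is
no contraction on leg `I`. -/
theorem HasNormSq.lower_classIIb {I J K : Fin 3} (hL : AreLegs I J K) (s : Bool)
    (x y w r t : ℕ) {c : ℂ}
    (hf : HasNormSq (dot s I J ^ x * (dot s J K ^ y * (dot s K J ^ w * (dot s I K ^ r *
      det s ^ t)))) c) :
    HasNormSq (dot s I J ^ (x + 1) * (dot s J K ^ y * (dot s K J ^ w * (dot s I K ^ r *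
      det s ^ t))))
      (((x : ℂ) + 1) * (x + w + t + 2) * (x + y + w + r + t + 3) / (x + y + w + t + 2) *
        c) := by
  obtain ⟨hIJ, hJK, hKI⟩ := hL
  have hr := ((((rep_det_pow s t).link_pow s I K r).link_pow s K J w).link_pow s J K
    y).link_pow s I J (x + 1)
  rw [pow_succ', mul_assoc] at hr ⊢
  refine hf.dot_mul hr.harmonic hr.red_eq ?_
  rw [← mul_assoc, ← pow_succ'] at hr
  rw [hr.red_con_eq (P := K) (m := x + r + t) (n := x + 1 + w + y + t)
    (F := ((x : ℂ) + 1) • (dot s I J ^ x * (dot s J K ^ y * (dot s K J ^ w * (dot s I K ^ r *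
      det s ^ t)))))
    (G := dot s I J ^ (x + 1) * (dot s J K ^ y * (dpow (dot s K J) w * (dot s I K ^ r *
      det s ^ t))))
    (H := (-(((x + 1 + w + y + t : ℕ) : ℂ) + 1)⁻¹ * (x + 1)) • (dot s I J ^ x *
      (dpow (dot s J K) y * (dot s K J ^ w * (dot s I K ^ (r + 1) * det s ^ t)))))
    (k := (x : ℂ) + 1) (p := x + r + t) (q := 0)
    ⟨hIJ, hJK, hKI⟩ ?_ ?_ rfl ?_ ?_ ?_ ?_ ?_ ?_ ?_]
  -- `e1`, `e2`: no contraction on leg `I`; `e3`, `e4`: the polarizations of `G` and `H`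
  · have e1 : con s I I (dot s I J ^ (x + 1) * (dot s J K ^ y * (dpow (dot s K J) w *
        (dot s I K ^ r * det s ^ t)))) = 0 := by
      rw [con_apply]
      refine Finset.sum_eq_zero fun α _ => ?_
      rw [show d (!s) I α _ = 0 from ?_, map_zero]
      simp [-Derivation.leibniz, derivation_mul, derivation_pow, d_not_dot, d_not_det, hIJ,
        hJK, hKI, hIJ.symm, hJK.symm, hKI.symm, derivation_dpow_eq_zero]
    have e2 : con s I I ((-(((x + 1 + w + y + t : ℕ) : ℂ) + 1)⁻¹ * (x + 1)) • (dot s I J ^ x *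
        (dpow (dot s J K) y * (dot s K J ^ w * (dot s I K ^ (r + 1) * det s ^ t))))) = 0 := by
      rw [map_smul, con_apply]
      convert smul_zero _
      refine Finset.sum_eq_zero fun α _ => ?_
      rw [show d (!s) I α _ = 0 from ?_, map_zero]
      simp [-Derivation.leibniz, derivation_mul, derivation_pow, d_not_dot, d_not_det, hIJ,
        hJK, hKI, hIJ.symm, hJK.symm, hKI.symm, derivation_dpow_eq_zero]
    have e3 : red (pol s K I (dot s I J ^ (x + 1) * (dot s J K ^ y * (dpow (dot s K J) w *
        (dot s I K ^ r * det s ^ t))))) = (((x : ℂ) + 1) * w) • red (dot s I J ^ x *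
          (dot s J K ^ y * (dot s K J ^ w * (dot s I K ^ r * det s ^ t)))) := by
      rw [← red_smul]
      have h := congrArg red (mul_dpow (dot s K J) w)
      have h0 : pol s K I (dot s K J) = 0 := by simp [pol_dot, hKI.symm]
      simp only [derivation_mul, derivation_pow, pol_dot, pol_det, hIJ, hJK, hKI, hIJ.symm,
        hJK.symm, hKI.symm, dpow_succ, if_true, if_false, mul_zero, add_zero, zero_add,
        Algebra.smul_def, map_mul, map_add, red_dot_self, map_pow,
        derivation_dpow_eq_zero h0] at h ⊢
      linear_combination ((red (algebraMap ℂ Fock x) + red (algebraMap ℂ Fock 1)) *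
        red (dot s I J) ^ x * red (dot s J K) ^ y * red (dot s I K) ^ r * red (det s) ^ t) * h
    have e4 : red (pol s J I (dot s I J ^ x *
      (dpow (dot s J K) y * (dot s K J ^ w * (dot s I K ^ (r + 1) * det s ^ t))))) =
        (((r : ℂ) + 1) * y) • red (dot s I J ^ x *
          (dot s J K ^ y * (dot s K J ^ w * (dot s I K ^ r * det s ^ t)))) := by
      rw [← red_smul]
      have h := congrArg red (mul_dpow (dot s J K) y)
      have h0 : pol s J I (dot s J K) = 0 := by simp [pol_dot, hIJ]
      simp only [derivation_mul, derivation_pow, pol_dot, pol_det, hIJ, hJK, hKI, hIJ.symm,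
        hJK.symm, hKI.symm, dpow_succ, if_true, if_false, mul_zero, add_zero, zero_add,
        Algebra.smul_def, map_mul, map_add, red_dot_self, map_pow,
        derivation_dpow_eq_zero h0] at h ⊢
      linear_combination ((red (algebraMap ℂ Fock r) + red (algebraMap ℂ Fock 1)) *
        red (dot s I J) ^ x * red (dot s K J) ^ w * red (dot s I K) ^ r * red (det s) ^ t) * h
    rw [e1, e2, e3, Derivation.map_smul, red_smul _ (pol s J I _), e4]
    simp only [map_zero, mul_zero, add_zero, sub_zero, smul_zero]
    rw [smul_smul, ← add_smul, ← add_smul, ← red_smul]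
    congr 2
    have h1 := natCast_add_two_ne_zero (x + w + y + t)
    have h2 := natCast_add_two_ne_zero (x + y + w + t)
    have h3 : ((x + 1 + w + y + t : ℕ) : ℂ) + 1 = x + y + w + t + 2 := by push_cast; ring
    rw [h3]
    push_cast at h1 h2 ⊢
    field_simp
    ring
  · fin_cases s <;> simp [linkWt, triWt_apply, modeWt, hIJ, hJK, hKI, hIJ.symm, hJK.symm,
      hKI.symm] <;> omega
  · fin_cases s <;> simp [linkWt, triWt_apply, modeWt, hIJ, hJK, hKI, hIJ.symm, hJK.symm,
      hKI.symm] <;> omega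
  · intro α
    simp only [derivation_mul, derivation_pow, d_not_dot, d_not_det, hIJ, hJK, hKI, hIJ.symm,
      hJK.symm, hKI.symm, dpow_succ, if_true, if_false, mul_zero, add_zero, Algebra.smul_def]
    ring
  · have h0 : pol s K J (dot s K J) = 0 := by simp [pol_dot, hJK]
    have hC (k : ℂ) : pol s I J (algebraMap ℂ Fock k) = 0 := Derivation.map_algebraMap _ k
    generalize -(((x + 1 + w + y + t : ℕ) : ℂ) + 1)⁻¹ = k0
    simp only [derivation_mul, derivation_pow, pol_dot, pol_det, hIJ, hJK, hKI, hIJ.symm,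
      hJK.symm, hKI.symm, dpow_succ, if_true, if_false, mul_zero, add_zero, zero_add,
      Algebra.smul_def, map_mul, map_add, red_dot_self, map_pow,
      derivation_dpow_eq_zero h0, hC]
    ring
  · refine Eig.congr (((eig_pol_dot ..).pow x).mul (((eig_pol_dot ..).pow y).mul
      (((eig_pol_dot ..).pow w).mul (((eig_pol_dot ..).pow r).mul
      ((eig_pol_det ..).pow t))))) ?_
    simp [hIJ, hJK, hKI, hIJ.symm, hJK.symm, hKI.symm]
    ring
  · refine Eig.congr (((eig_pol_not_dot ..).pow x).mul (((eig_pol_not_dot ..).pow y).mul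
      (((eig_pol_not_dot ..).pow w).mul (((eig_pol_not_dot ..).pow r).mul
      ((eig_pol_not_det ..).pow t))))) ?_
    simp [hIJ, hJK, hKI, hIJ.symm, hJK.symm, hKI.symm]
  · push_cast
    ring
  · refine Eig.congr (((eig_legNum_dot ..).pow (x + 1)).mul (((eig_legNum_dot ..).pow y).mul
      (((eig_legNum_dot ..).dpow w).mul (((eig_legNum_dot ..).pow r).mul
      ((eig_legNum_det ..).pow t))))) ?_
    simp [hIJ, hJK, hKI, hIJ.symm, hJK.symm, hKI.symm]
    ring
  · refine Eig.congr ((((eig_legNum_dot ..).pow x).mul (((eig_legNum_dot ..).dpow y).mul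
      (((eig_legNum_dot ..).pow w).mul (((eig_legNum_dot ..).pow (r + 1)).mul
      ((eig_legNum_det ..).pow t))))).smul _) ?_
    simp [hIJ, hJK, hKI, hIJ.symm, hJK.symm, hKI.symm]
    ring

/-- Removal of one link `(J, K)` in the presence of the links `(I, J)`, `(J, I)`, `(I, K)`. The
opposite triplet of leg `K` also occurs in the links `(I, K)`, which gives the state `G` of
`Rep.red_con_eq`. There is no contraction on leg `K`, whose `s`-triplet occurs in the determinant
only, but there is one on leg `J`. -/
theorem HasNormSq.lower_classIIa {I J K : Fin 3} (hL : AreLegs I J K) (s : Bool)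
    (x y z w t : ℕ) {c : ℂ}
    (hf : HasNormSq (dot s J K ^ y * (dot s I J ^ x * (dot s J I ^ z * (dot s I K ^ w *
      det s ^ t)))) c) :
    HasNormSq (dot s J K ^ (y + 1) * (dot s I J ^ x * (dot s J I ^ z * (dot s I K ^ w *
      det s ^ t))))
      (((y : ℂ) + 1) * (y + z + t + 2) * (x + y + z + w + t + 3) / (x + y + z + t + 2) *
        c) := by
  obtain ⟨hIJ, hJK, hKI⟩ := hL
  have hr := ((((rep_det_pow s t).link_pow s I K w).link_pow s J I z).link_pow s I J
    x).link_pow s J K (y + 1)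
  rw [pow_succ', mul_assoc] at hr ⊢
  refine hf.dot_mul hr.harmonic hr.red_eq ?_
  rw [← mul_assoc, ← pow_succ'] at hr
  rw [hr.red_con_eq (P := I) (m := y + z + t + x) (n := y + 1 + w + t)
    (F := ((y : ℂ) + 1) • (dot s J K ^ y * (dot s I J ^ x * (dot s J I ^ z * (dot s I K ^ w *
      det s ^ t)))))
    (G := dot s J K ^ (y + 1) * (dot s I J ^ x * (dot s J I ^ z * (dpow (dot s I K) w *
      det s ^ t))))
    (H := 0) (k := (y : ℂ) + 1) (p := y + z + t) (q := x)
    ⟨hJK, hKI, hIJ⟩ ?_ ?_ rfl ?_ ?_ ?_ ?_ ?_ ?_ (eig_zero _ _)]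
  · have h0 : pol s I J (dot s I K) = 0 := by simp [pol_dot, hIJ.symm]
    have h0' : pol s I J (dot s I J) = 0 := by simp [pol_dot, hIJ.symm]
    have h := congrArg red (mul_dpow (dot s I K) w)
    have h' := congrArg red (mul_dpow (dot s I J) x)
    -- a pair of links `(I, J)`, `(J, K)` is contracted to a link `(I, K)`
    have e1 : con s J J (dot s J K ^ (y + 1) * (dot s I J ^ x * (dot s J I ^ z *
        (dpow (dot s I K) w * det s ^ t)))) = pol s I J (dot s J K ^ (y + 1) *
          (dpow (dot s I J) x * (dot s J I ^ z * (dpow (dot s I K) w * det s ^ t)))) := by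
      rw [con_eq_of_d (A := I) (P := I) (F := dot s J K ^ (y + 1) *
          (dpow (dot s I J) x * (dot s J I ^ z * (dpow (dot s I K) w * det s ^ t)))) (G := 0)
          hIJ.symm hIJ.symm, map_zero, add_zero]
      intro α
      have h1 : d (!s) J α (dot s I K) = 0 := by simp [d_not_dot, hJK]
      simp only [derivation_mul, derivation_pow, d_not_dot, d_not_det, hIJ, hJK, hKI, hIJ.symm,
        hJK.symm, hKI.symm, if_true, if_false, mul_zero, add_zero, derivation_dpow_eq_zero h1]
      ring
    have e2 : red (dot s I J * con s J J (dot s J K ^ (y + 1) * (dot s I J ^ x *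
        (dot s J I ^ z * (dpow (dot s I K) w * det s ^ t))))) =
        (((y : ℂ) + 1) * x * w) • red (dot s J K ^ y * (dot s I J ^ x * (dot s J I ^ z *
          (dot s I K ^ w * det s ^ t)))) := by
      rw [← red_smul, e1]
      simp only [derivation_mul, derivation_pow, pol_dot, pol_det, hIJ, hJK, hKI, hIJ.symm,
        hJK.symm, hKI.symm, dpow_succ, if_true, if_false, mul_zero, add_zero, zero_add,
        Algebra.smul_def, map_mul, map_add, red_dot_self, map_pow,
        derivation_dpow_eq_zero h0, derivation_dpow_eq_zero h0'] at h h' ⊢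
      linear_combination ((red (algebraMap ℂ Fock y) + red (algebraMap ℂ Fock 1)) *
        red (dot s J K) ^ y * red (dot s J I) ^ z * red (det s) ^ t) *
        (red (dot s I J) * red (dpow (dot s I J) x) * h +
          red (algebraMap ℂ Fock w) * red (dot s I K) ^ w * h')
    have e3 : red (pol s I J (dot s J K ^ (y + 1) * (dot s I J ^ x *
        (dot s J I ^ z * (dpow (dot s I K) w * det s ^ t))))) =
        (((y : ℂ) + 1) * w) • red (dot s J K ^ y * (dot s I J ^ x * (dot s J I ^ z *
          (dot s I K ^ w * det s ^ t)))) := by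
      rw [← red_smul]
      simp only [derivation_mul, derivation_pow, pol_dot, pol_det, hIJ, hJK, hKI, hIJ.symm,
        hJK.symm, hKI.symm, dpow_succ, if_true, if_false, mul_zero, add_zero, zero_add,
        Algebra.smul_def, map_mul, map_add, red_dot_self, map_pow,
        derivation_dpow_eq_zero h0] at h ⊢
      linear_combination ((red (algebraMap ℂ Fock y) + red (algebraMap ℂ Fock 1)) *
        red (dot s J K) ^ y * red (dot s I J) ^ x * red (dot s J I) ^ z * red (det s) ^ t) * h
    rw [e2, e3]
    simp only [map_zero, mul_zero, add_zero]
    rw [smul_smul, ← add_smul, ← sub_smul, ← red_smul]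
    congr 2
    have h1 := natCast_add_two_ne_zero (y + z + t + x)
    have h2 := natCast_add_two_ne_zero (x + y + z + t)
    push_cast at h1 h2 ⊢
    field_simp
    ring
  · fin_cases s <;> simp [linkWt, triWt_apply, modeWt, hIJ, hJK, hKI, hIJ.symm, hJK.symm,
      hKI.symm] <;> omega
  · fin_cases s <;> simp [linkWt, triWt_apply, modeWt, hIJ, hJK, hKI, hIJ.symm, hJK.symm,
      hKI.symm]
    omega
  · intro α
    simp only [derivation_mul, derivation_pow, d_not_dot, d_not_det, hIJ, hJK, hKI, hIJ.symm,
      hJK.symm, hKI.symm, dpow_succ, if_true, if_false, mul_zero, add_zero, Algebra.smul_def]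
    ring
  · have h0 : pol s I K (dot s I K) = 0 := by simp [pol_dot, hKI]
    simp [-Derivation.leibniz, derivation_mul, derivation_pow, pol_dot, pol_det, hIJ, hJK,
      hKI, hIJ.symm, hJK.symm, hKI.symm, derivation_dpow_eq_zero h0]
  · refine Eig.congr (((eig_pol_dot ..).pow y).mul (((eig_pol_dot ..).pow x).mul
      (((eig_pol_dot ..).pow z).mul (((eig_pol_dot ..).pow w).mul
      ((eig_pol_det ..).pow t))))) ?_
    simp [hIJ, hJK, hKI, hIJ.symm, hJK.symm, hKI.symm]
    ring
  · refine Eig.congr (((eig_pol_not_dot ..).pow y).mul (((eig_pol_not_dot ..).pow x).mul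
      (((eig_pol_not_dot ..).pow z).mul (((eig_pol_not_dot ..).pow w).mul
      ((eig_pol_not_det ..).pow t))))) ?_
    simp [hIJ, hJK, hKI, hIJ.symm, hJK.symm, hKI.symm]
  · push_cast
    ring
  · refine Eig.congr (((eig_legNum_dot ..).pow (y + 1)).mul (((eig_legNum_dot ..).pow x).mul
      (((eig_legNum_dot ..).pow z).mul (((eig_legNum_dot ..).dpow w).mul
      ((eig_legNum_det ..).pow t))))) ?_
    simp [hIJ, hJK, hKI, hIJ.symm, hJK.symm, hKI.symm]
    ring

/-! ### Powers of the determinant -/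

theorem sum_d_u_mul_det_pow (s : Bool) (I : Fin 3) (t : ℕ) :
    ∑ α, d s I α (u s I α * det s ^ t) = ((t : ℂ) + 3) • det s ^ t := by
  have h : pol s I I (det s ^ t) = ((t : ℂ) * 1) • det s ^ t := (eig_pol_det s I).pow t
  rw [sum_d_u_mul, if_pos rfl, h]
  module

/-- The curl, in the triplet of the leg `1`, of the gradient of a power of the determinant in the
triplet of the leg `0`; the hypothesis says that `(a, b, c)` is a cyclic arrangement of the colours. -/
theorem d_d_det_pow (s : Bool) (t : ℕ) {a b c : Fin 3}
    (h : (a, b, c) = (0, 1, 2) ∨ (a, b, c) = (1, 2, 0) ∨ (a, b, c) = (2, 0, 1)) :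
    d s 1 b (d s 0 a (det s ^ (t + 1))) - d s 1 a (d s 0 b (det s ^ (t + 1))) =
      (((t : ℂ) + 1) * (t + 2)) • (u s 2 c * det s ^ t) := by
  have h1 := mul_dpow (det s) t
  have e1 : d s 0 a (det s) * d s 1 b (det s) - d s 0 b (det s) * d s 1 a (det s) =
      u s 2 c * det s := by
    rw [det_eq]
    rcases h with h | h | h <;> simp only [Prod.mk.injEq] at h <;> obtain ⟨rfl, rfl, rfl⟩ := h <;>
      simp [-Derivation.leibniz, derivation_mul, d_u] <;> ring
  have e2 : d s 1 b (d s 0 a (det s)) - d s 1 a (d s 0 b (det s)) = 2 * u s 2 c := by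
    rw [det_eq]
    rcases h with h | h | h <;> simp only [Prod.mk.injEq] at h <;> obtain ⟨rfl, rfl, rfl⟩ := h <;>
      simp [-Derivation.leibniz, derivation_mul, d_u] <;> ring
  simp only [derivation_pow, dpow_succ, derivation_mul, Derivation.map_smul]
  simp only [Algebra.smul_def, map_mul, map_add, map_one, map_ofNat] at h1 ⊢
  linear_combination (algebraMap ℂ Fock t + 1) * (dpow (det s) t * e1 + det s ^ t * e2 +
    u s 2 c * h1)

/-- Cayley's identity for the determinant of three triplets: the differential operator obtained from
the determinant lowers its powers. -/
theorem cayley (s : Bool) (t : ℕ) :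
    ∑ σ : Equiv.Perm (Fin 3), ((Equiv.Perm.sign σ : ℤ) : ℂ) •
      d s 2 (σ 2) (d s 1 (σ 1) (d s 0 (σ 0) (det s ^ (t + 1)))) =
      (((t : ℂ) + 1) * (t + 2) * (t + 3)) • det s ^ t := by
  rw [sum_perm_three fun a b c => d s 2 c (d s 1 b (d s 0 a (det s ^ (t + 1))))]
  have h2 := congrArg (d s 2 2) (d_d_det_pow s t (.inl rfl))
  have h0 := congrArg (d s 2 0) (d_d_det_pow s t (.inr (.inl rfl)))
  have h1 := congrArg (d s 2 1) (d_d_det_pow s t (.inr (.inr rfl)))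
  have h := sum_d_u_mul_det_pow s 2 t
  rw [Fin.sum_univ_three] at h
  simp only [map_sub, Derivation.map_smul] at h0 h1 h2
  rw [mul_smul, ← h, smul_add, smul_add, ← h0, ← h1, ← h2]
  abel

theorem fockInner_det_mul (s : Bool) (f g : Fock) :
    fockInner (det s * f) g =
      fockInner f (∑ σ : Equiv.Perm (Fin 3), ((Equiv.Perm.sign σ : ℤ) : ℂ) •
        d s 2 (σ 2) (d s 1 (σ 1) (d s 0 (σ 0) g))) := by
  rw [det, Finset.sum_mul, fockInner_sum_left, fockInner_sum_right]
  refine Finset.sum_congr rfl fun σ _ => ?_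
  rw [smul_mul_assoc, fockInner_smul_left, mul_assoc, mul_assoc, fockInner_u_mul,
    fockInner_u_mul, fockInner_u_mul, ← inner_eq, ← inner_eq, inner_smul_right, map_intCast]

theorem fockInner_det_pow (s : Bool) (t : ℕ) :
    fockInner (det s ^ t) (det s ^ t) = (normSqI 0 0 0 0 t : ℂ) := by
  induction t with
  | zero =>
    have h : fockInner (1 : Fock) 1 = 1 := by
      change fockInner (monomial 0 1) (monomial 0 1) = 1
      rw [fockInner_monomial]
      simp [occFactorial]
    simp [normSqI, h]
  | succ t ih =>
    rw [pow_succ', fockInner_det_mul, ← pow_succ', cayley, ← inner_eq, inner_smul_right,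
      inner_eq, ih]
    simp only [normSqI, zero_add, Nat.factorial_succ]
    push_cast
    ring

theorem harmonic_det_pow (s : Bool) (t : ℕ) : Harmonic (det s ^ t) := fun I => by
  have h : con s I I (det s ^ t) = 0 := by
    rw [con_apply]
    refine Finset.sum_eq_zero fun α _ => ?_
    rw [derivation_pow, d_not_det, mul_zero, map_zero]
  cases s
  · rwa [← con_not_self] at h
  · exact h

theorem hasNormSq_det_pow (s : Bool) (t : ℕ) :
    HasNormSq (det s ^ t) (normSqI 0 0 0 0 t : ℂ) :=
  ⟨_, harmonic_det_pow s t, rfl, fockInner_det_pow s t⟩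

/-! ### The closed forms -/

theorem normSqI_succ_ij (x t : ℕ) (w : ℕ) : normSqI (x + 1) 0 0 w t =
    ((x : ℝ) + 1) * (x + w + t + 2) * (x + w + t + 3) / (x + w + t + 2) * normSqI x 0 0 w t := by
  have h : x + 1 + w + t + 1 = x + w + t + 1 + 1 := by ring
  simp only [normSqI, Nat.factorial_succ, h]
  push_cast
  field_simp
  ring

theorem normSqI_succ_ji (x y z w t : ℕ) : normSqI x y (z + 1) w t =
    ((z : ℝ) + 1) * (z + y + t + 2) * (x + y + z + w + t + 3) / (x + y + z + w + t + 2) *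
      normSqI x y z w t := by
  have h : y + (z + 1) + t + 1 = y + z + t + 1 + 1 := by ring
  simp only [normSqI, Nat.factorial_succ, h]
  push_cast
  field_simp
  ring

theorem choose_succ_div (n k : ℕ) : ((n + k + 1).choose k : ℝ) =
    ((n : ℝ) + k + 1) / (n + 1) * ((n + k).choose k : ℝ) := by
  have h := Nat.choose_mul_succ_eq (n + k) k
  have e : n + k + 1 - k = n + 1 := by omega
  rw [e] at h
  have h' : (((n + k).choose k : ℕ) : ℝ) * (n + k + 1) = ((n + k + 1).choose k : ℝ) * (n + 1) := by
    exact_mod_cast h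
  field_simp
  linarith

theorem normSqIIa_succ_jk (x y z w t : ℕ) : normSqIIa x (y + 1) z w t =
    ((y : ℝ) + 1) * (y + z + t + 2) * (x + y + z + w + t + 3) / (x + y + z + t + 2) *
      normSqIIa x y z w t := by
  have h : y + 1 + z + t + 1 = y + z + t + 1 + 1 := by ring
  have e : x + (y + 1) + z + w + t + 1 = (x + y + z + t + 1) + w + 1 := by ring
  have e' : x + y + z + w + t + 1 = (x + y + z + t + 1) + w := by ring
  simp only [normSqIIa, Nat.factorial_succ, h, e, e', choose_succ_div]
  push_cast
  field_simp
  ring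

theorem normSqIIb_succ_ij (x y w r t : ℕ) : normSqIIb (x + 1) y w r t =
    ((x : ℝ) + 1) * (x + w + t + 2) * (x + y + w + r + t + 3) / (x + y + w + t + 2) *
      normSqIIb x y w r t := by
  have h : x + 1 + w + t + 1 = x + w + t + 1 + 1 := by ring
  have e : x + 1 + y + w + r + t + 1 = (x + y + w + t + 1) + r + 1 := by ring
  have e' : x + y + w + r + t + 1 = (x + y + w + t + 1) + r := by ring
  simp only [normSqIIb, Nat.factorial_succ, h, e, e', choose_succ_div]
  push_cast
  field_simp
  ring

/-- Class I is symmetric under interchanging the two outer legs. -/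
theorem normSqI_swap (ij jk ji kj t : ℕ) : normSqI ij jk ji kj t = normSqI kj ji jk ij t := by
  have h1 : ij + ji + jk + kj + t + 2 = kj + jk + ji + ij + t + 2 := by ring
  have h2 : ij + kj + t + 1 = kj + ij + t + 1 := by ring
  have h3 : jk + ji + t + 1 = ji + jk + t + 1 := by ring
  simp only [normSqI, h1, h2, h3]
  ring

/-- Class I is symmetric under interchanging the two kinds of oscillators. -/
theorem normSqI_dual (ij jk ji kj t : ℕ) : normSqI ij jk ji kj t = normSqI ji kj ij jk t := by
  have h1 : ij + ji + jk + kj + t + 2 = ji + ij + kj + jk + t + 2 := by ring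
  have h2 : ij + kj + t + 1 = kj + ij + t + 1 := by ring
  have h3 : jk + ji + t + 1 = ji + jk + t + 1 := by ring
  simp only [normSqI, h1, h2, h3]
  ring

/-- Class IIa without `ℓ_{JK}` is class I with middle leg `I`. -/
theorem normSqIIa_zero (x z w t : ℕ) : normSqIIa x 0 z w t = normSqI z w x 0 t := by
  have h0 : ((x + z + w + t + 1).choose w : ℝ) ≠ 0 := by
    exact_mod_cast (Nat.choose_pos (by omega)).ne'
  have h1 : z + x + w + 0 + t + 2 = x + 0 + z + w + t + 2 := by ring
  have h2 : w + x + t + 1 = x + w + t + 1 := by ring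
  have h3 : z + 0 + t + 1 = 0 + z + t + 1 := by ring
  have h4 : x + 0 + z + w + t + 1 = x + z + w + t + 1 := by ring
  simp only [normSqI, normSqIIa, h1, h2, h3, h4]
  rw [← mul_assoc, mul_div_cancel_right₀ _ h0]
  simp
  ring

/-- Class IIb without `ℓ_{IJ}` is class I with middle leg `K`. -/
theorem normSqIIb_zero (y w r t : ℕ) : normSqIIb 0 y w r t = normSqI r w 0 y t := by
  have h0 : ((y + w + r + t + 1).choose r : ℝ) ≠ 0 := by
    exact_mod_cast (Nat.choose_pos (by omega)).ne'
  have h1 : r + 0 + w + y + t + 2 = 0 + y + w + r + t + 2 := by ring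
  have h2 : r + y + t + 1 = y + r + t + 1 := by ring
  have h3 : w + 0 + t + 1 = 0 + w + t + 1 := by ring
  have h4 : 0 + y + w + r + t + 1 = y + w + r + t + 1 := by ring
  simp only [normSqI, normSqIIb, h1, h2, h3, h4]
  rw [← mul_assoc, mul_div_cancel_right₀ _ h0]
  simp
  ring

/-- Interchanging the two kinds of oscillators and the legs `I`, `K` exchanges the classes IIa and
IIb. -/
theorem normSqIIa_eq_normSqIIb (ij jk ji ik t : ℕ) :
    normSqIIa ij jk ji ik t = normSqIIb jk ij ji ik t := by
  have h1 : ij + jk + ji + ik + t + 2 = jk + ij + ji + ik + t + 2 := by ring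
  have h2 : ij + jk + ji + ik + t + 1 = jk + ij + ji + ik + t + 1 := by ring
  simp only [normSqIIa, normSqIIb, h1, h2]
  ring

theorem normSqI_pos (ij jk ji kj t : ℕ) : 0 < normSqI ij jk ji kj t := by
  unfold normSqI
  positivity

/-! ### Norms of the polynomial representatives -/

theorem AreLegs.swap {I J K : Fin 3} (h : AreLegs I J K) : AreLegs K J I :=
  ⟨h.2.1.symm, h.1.symm, h.2.2.symm⟩

theorem AreLegs.swap_left {I J K : Fin 3} (h : AreLegs I J K) : AreLegs J I K :=
  ⟨h.1.symm, h.2.2.symm, h.2.1.symm⟩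

theorem AreLegs.swap_right {I J K : Fin 3} (h : AreLegs I J K) : AreLegs I K J :=
  ⟨h.2.2.symm, h.2.1.symm, h.1.symm⟩

theorem hasNormSq_classI {I J K : Fin 3} (h : AreLegs I J K) (s : Bool) (x y z w t : ℕ) :
    HasNormSq (dot s J I ^ z * (dot s I J ^ x * (dot s J K ^ y * (dot s K J ^ w * det s ^ t))))
      (normSqI x y z w t : ℂ) := by
  -- without links out of the middle leg, the links into it fall under class IIb
  have hw : HasNormSq (dot s K J ^ w * det s ^ t) (normSqI 0 0 0 w t : ℂ) := by
    rw [normSqI_swap]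
    induction w with
    | zero => simpa using hasNormSq_det_pow s t
    | succ w ih =>
      have := HasNormSq.lower_classIIb h.swap s w 0 0 0 t (c := normSqI w 0 0 0 t)
        (by simpa using ih)
      simp only [pow_zero, one_mul] at this
      refine this.congr ?_
      rw [normSqI_succ_ij]
      push_cast
      ring
  have hx : HasNormSq (dot s I J ^ x * (dot s K J ^ w * det s ^ t))
      (normSqI x 0 0 w t : ℂ) := by
    induction x with
    | zero => simpa using hw
    | succ x ih =>
      have := HasNormSq.lower_classIIb h s x 0 w 0 t (c := normSqI x 0 0 w t)
        (by simpa using ih)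
      simp only [pow_zero, one_mul] at this
      refine this.congr ?_
      rw [normSqI_succ_ij]
      push_cast
      ring
  -- the links out of the middle leg; those to `K` by exchanging the outer legs
  have hy : HasNormSq (dot s I J ^ x * (dot s J K ^ y * (dot s K J ^ w * det s ^ t)))
      (normSqI x y 0 w t : ℂ) := by
    induction y with
    | zero => simpa using hx
    | succ y ih =>
      have := HasNormSq.lower_classI h.swap s w 0 y x t (c := normSqI x y 0 w t)
        (by
          refine Eq.mp ?_ ih
          congr 1
          ring)
      refine Eq.mp ?_ this
      rw [normSqI_swap x (y + 1), normSqI_succ_ji, normSqI_swap x y]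
      congr 1
      · ring
      · push_cast
        ring
  induction z with
  | zero => simpa using hy
  | succ z ih =>
    refine (HasNormSq.lower_classI h s x y z w t ih).congr ?_
    rw [normSqI_succ_ji]
    push_cast
    ring

theorem hasNormSq_classIIa {I J K : Fin 3} (h : AreLegs I J K) (s : Bool) (x y z w t : ℕ) :
    HasNormSq (dot s J K ^ y * (dot s I J ^ x * (dot s J I ^ z * (dot s I K ^ w * det s ^ t))))
      (normSqIIa x y z w t : ℂ) := by
  induction y with
  | zero =>
    have := hasNormSq_classI h.swap_left s z w x 0 t
    rw [← normSqIIa_zero, pow_zero, one_mul] at this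
    rw [pow_zero, one_mul, mul_left_comm (dot s J I ^ z)]
    rwa [mul_left_comm (dot s J I ^ z)] at this
  | succ y ih =>
    refine (HasNormSq.lower_classIIa h s x y z w t ih).congr ?_
    rw [normSqIIa_succ_jk]
    push_cast
    ring

theorem hasNormSq_classIIb {I J K : Fin 3} (h : AreLegs I J K) (s : Bool) (x y w r t : ℕ) :
    HasNormSq (dot s I J ^ x * (dot s J K ^ y * (dot s K J ^ w * (dot s I K ^ r * det s ^ t))))
      (normSqIIb x y w r t : ℂ) := by
  induction x with
  | zero =>
    have := hasNormSq_classI h.swap_right s r w 0 y t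
    rw [← normSqIIb_zero, pow_zero, one_mul] at this
    rw [pow_zero, one_mul]
    have e : dot s J K ^ y * (dot s K J ^ w * (dot s I K ^ r * det s ^ t)) =
        dot s I K ^ r * (dot s K J ^ w * (dot s J K ^ y * det s ^ t)) := by ring
    rwa [e]
  | succ x ih =>
    refine (HasNormSq.lower_classIIb h s x y w r t ih).congr ?_
    rw [normSqIIb_succ_ij]
    push_cast
    ring

/-! ### Naive kets as harmonic representatives -/

/-- The kind of triplets whose determinant generates the state `|t⟩`: `a` for `t ≥ 0` and `b` for
`t < 0`. -/
def side (t : ℤ) : Bool := decide (0 ≤ t)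

theorem tKet_eq (t : ℤ) : tKet t = (tri (side t) ^ t.natAbs) vacuum := by
  unfold tKet side
  by_cases h : 0 ≤ t
  · have e : t.toNat = t.natAbs := by omega
    rw [if_pos h, decide_eq_true h, e, tri_true]
  · have e : (-t).toNat = t.natAbs := by omega
    rw [if_neg h, decide_eq_false h, e, tri_false]

/-- The polynomial represented by a naive ket modulo the leg traces. -/
def Label.poly (s : Label) : Fock :=
  dot true 0 1 ^ s.l12 * (dot true 1 2 ^ s.l23 * (dot true 2 0 ^ s.l31 * (dot true 1 0 ^ s.l21 *
    (dot true 2 1 ^ s.l32 * (dot true 0 2 ^ s.l13 * det (side s.t) ^ s.absT)))))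

/-- The weight of a naive ket. -/
def Label.wt (s : Label) : Bool → Fin 3 → ℕ := fun k I => if k then s.p I else s.q I

theorem rep_tKet (t : ℤ) : Rep (t.natAbs • triWt (side t)) (det (side t) ^ t.natAbs) (tKet t) := by
  rw [tKet_eq]
  exact rep_det_pow _ _

theorem rep_naiveKet (s : Label) : Rep s.wt s.poly (naiveKet s) := by
  refine (((((((rep_tKet s.t).link_pow true 0 2 s.l13).link_pow true 2 1 s.l32).link_pow true 1 0
    s.l21).link_pow true 2 0 s.l31).link_pow true 1 2 s.l23).link_pow true 0 1 s.l12).congr_wt ?_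
  funext k I
  have h1 : (if 0 ≤ s.t then s.t.natAbs else 0) = s.t.toNat := by split_ifs <;> omega
  have h2 : (if s.t < 0 then s.t.natAbs else 0) = (-s.t).toNat := by split_ifs <;> omega
  cases k <;> fin_cases I <;>
    simp [Label.wt, linkWt, modeWt, triWt_apply, side, Label.p, Label.q, Label.ell,
      Fin.sum_univ_three, h1, h2] <;> ring

theorem Label.poly_eq {I J K : Fin 3} (h : AreLegs I J K) (s : Label) :
    s.poly = dot true I J ^ s.ell I J * dot true J K ^ s.ell J K * dot true K I ^ s.ell K I *
      dot true J I ^ s.ell J I * dot true K J ^ s.ell K J * dot true I K ^ s.ell I K *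
      det (side s.t) ^ s.absT := by
  revert h
  fin_cases I <;> fin_cases J <;> fin_cases K <;> simp [AreLegs, Label.ell, Label.poly] <;> ring

/-- A product of four links on `|t⟩` is the naive ket with the same polynomial: the order of the
links is immaterial. -/
theorem naiveKet_eq_of_poly_eq {s : Label} {I₁ J₁ I₂ J₂ I₃ J₃ I₄ J₄ : Fin 3} {a b c e : ℕ}
    (h : s.poly = dot true I₁ J₁ ^ a * (dot true I₂ J₂ ^ b * (dot true I₃ J₃ ^ c *
      (dot true I₄ J₄ ^ e * det (side s.t) ^ s.absT)))) :
    naiveKet s = (LDag I₁ J₁ ^ a * LDag I₂ J₂ ^ b * LDag I₃ J₃ ^ c * LDag I₄ J₄ ^ e)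
      (tKet s.t) := by
  have hr := ((((rep_tKet s.t).link_pow true I₄ J₄ e).link_pow true I₃ J₃ c).link_pow true I₂ J₂
    b).link_pow true I₁ J₁ a
  exact (rep_naiveKet s).harmonic.eq_of_red_eq hr.harmonic
    ((rep_naiveKet s).red_eq.symm.trans ((congrArg red h).trans hr.red_eq))

theorem norm_naiveKet_sq {s : Label} {N : ℝ} (h : HasNormSq s.poly (N : ℂ)) :
    ‖naiveKet s‖ ^ 2 = N := by
  have h1 := h.of_rep (rep_naiveKet s)
  have h2 : ‖naiveKet s‖ ^ 2 = (fockInner (naiveKet s) (naiveKet s)).re :=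
    norm_sq_eq_re_inner (𝕜 := ℂ) _
  rw [h2, h1, Complex.ofReal_re]

theorem dot_false (I J : Fin 3) : dot false I J = dot true J I := dot_not true I J

theorem hasNormSq_poly_classI {s : Label} {I J K : Fin 3} (h : InClassI s I J K) :
    HasNormSq s.poly
      (normSqI (s.ell I J) (s.ell J K) (s.ell J I) (s.ell K J) s.absT : ℂ) := by
  obtain ⟨hL, h1, h2⟩ := h
  rw [Label.poly_eq hL, h1, h2]
  cases side s.t
  · have := hasNormSq_classI hL false (s.ell J I) (s.ell K J) (s.ell I J) (s.ell J K) s.absT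
    rw [← normSqI_dual] at this
    simp only [dot_false] at this
    convert this using 1
    ring
  · convert hasNormSq_classI hL true (s.ell I J) (s.ell J K) (s.ell J I) (s.ell K J) s.absT using 1
    ring

/-- For `t < 0` this is class IIb for the other kind of triplets, with the legs `I`, `K`
interchanged. -/
theorem hasNormSq_poly_classIIa {s : Label} {I J K : Fin 3} (h : InClassIIa s I J K) :
    HasNormSq s.poly
      (normSqIIa (s.ell I J) (s.ell J K) (s.ell J I) (s.ell I K) s.absT : ℂ) := by
  obtain ⟨hL, h1, h2⟩ := h
  rw [Label.poly_eq hL, h1, h2]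
  cases side s.t
  · have := hasNormSq_classIIb hL.swap false (s.ell J K) (s.ell I J) (s.ell J I) (s.ell I K) s.absT
    rw [← normSqIIa_eq_normSqIIb] at this
    simp only [dot_false] at this
    convert this using 1
    ring
  · convert hasNormSq_classIIa hL true (s.ell I J) (s.ell J K) (s.ell J I) (s.ell I K) s.absT
      using 1
    ring

/-- For `t < 0` this is class IIa for the other kind of triplets, with the legs `I`, `K`
interchanged. -/
theorem hasNormSq_poly_classIIb {s : Label} {I J K : Fin 3} (h : InClassIIb s I J K) :
    HasNormSq s.poly
      (normSqIIb (s.ell I J) (s.ell J K) (s.ell K J) (s.ell I K) s.absT : ℂ) := by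
  obtain ⟨hL, h1, h2⟩ := h
  rw [Label.poly_eq hL, h1, h2]
  cases side s.t
  · have := hasNormSq_classIIa hL.swap false (s.ell J K) (s.ell I J) (s.ell K J) (s.ell I K) s.absT
    rw [normSqIIa_eq_normSqIIb] at this
    simp only [dot_false] at this
    convert this using 1
    ring
  · convert hasNormSq_classIIb hL true (s.ell I J) (s.ell J K) (s.ell K J) (s.ell I K) s.absT
      using 1
    ring

theorem normSqIIa_pos (ij jk ji ik t : ℕ) : 0 < normSqIIa ij jk ji ik t := by
  have h1 : 0 < (ij + jk + ji + ik + t + 1).choose ik := Nat.choose_pos (by omega)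
  have h2 : 0 < (ij + ji + ik + t + 1).choose ik := Nat.choose_pos (by omega)
  unfold normSqIIa
  positivity

theorem normSqIIb_pos (ij jk kj ik t : ℕ) : 0 < normSqIIb ij jk kj ik t := by
  rw [← normSqIIa_eq_normSqIIb]
  exact normSqIIa_pos ..

theorem IsClosedForm.norm_sq_eq {s : Label} {N : ℝ} (h : IsClosedForm s N) :
    ‖naiveKet s‖ ^ 2 = N ∧ 0 < N := by
  obtain ⟨I, J, K, ⟨h, rfl⟩ | ⟨h, rfl⟩ | ⟨h, rfl⟩⟩ := h
  · exact ⟨norm_naiveKet_sq (hasNormSq_poly_classI h), normSqI_pos ..⟩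
  · exact ⟨norm_naiveKet_sq (hasNormSq_poly_classIIa h), normSqIIa_pos ..⟩
  · exact ⟨norm_naiveKet_sq (hasNormSq_poly_classIIb h), normSqIIb_pos ..⟩

/-! ### Sectors -/

theorem fockInner_pol_self (s : Bool) (I : Fin 3) (f g : Fock) :
    fockInner (pol s I I f) g = fockInner f (pol s I I g) := by
  rw [pol_apply, pol_apply, fockInner_sum_left, fockInner_sum_right]
  refine Finset.sum_congr rfl fun α _ => ?_
  rw [fockInner_u_mul, ← fockInner_conj_symm f, fockInner_u_mul, fockInner_conj_symm]

/-- States of different weights are orthogonal, the number operators being symmetric. -/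
theorem IsWt.fockInner_eq_zero {w w' : Bool → Fin 3 → ℕ} {f g : Fock} (hf : IsWt w f)
    (hg : IsWt w' g) (h : w ≠ w') : fockInner f g = 0 := by
  obtain ⟨s, hs⟩ := Function.ne_iff.mp h
  obtain ⟨I, hI⟩ := Function.ne_iff.mp hs
  have e := fockInner_pol_self s I f g
  rw [hf, hg, ← inner_eq, ← inner_eq, inner_smul_left, inner_smul_right, map_natCast] at e
  by_contra h0
  exact hI (by exact_mod_cast mul_right_cancel₀ h0 e)

theorem sameSector_iff_wt_eq (s s' : Label) : SameSector s s' ↔ s.wt = s'.wt := by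
  constructor
  · rintro ⟨hp, hq⟩
    funext k I
    simp only [Label.wt, hp, hq]
  · intro h
    exact ⟨funext fun I => by simpa [Label.wt] using congrFun (congrFun h true) I,
      funext fun I => by simpa [Label.wt] using congrFun (congrFun h false) I⟩

theorem inner_naiveKet_eq_zero {s s' : Label} (h : ¬ SameSector s s') :
    inner ℂ (naiveKet s) (naiveKet s') = 0 :=
  (rep_naiveKet s).wt'.fockInner_eq_zero (rep_naiveKet s').wt'
    (mt (sameSector_iff_wt_eq s s').mpr h)

/-- Labels of the same sector have the same `t`, because `3 t = ∑ I, (p_I - q_I)`, and their `ℓ`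
differ by an integer added to the three links of one cyclic orientation and subtracted from those of
the other. -/
theorem nondegenerate_iff (s : Label) : Nondegenerate s ↔
    (s.l12 = 0 ∨ s.l23 = 0 ∨ s.l31 = 0) ∧ (s.l21 = 0 ∨ s.l32 = 0 ∨ s.l13 = 0) := by
  have hsector (s s' : Label) : SameSector s s' ↔
      (s.p 0 = s'.p 0 ∧ s.p 1 = s'.p 1 ∧ s.p 2 = s'.p 2) ∧
        (s.q 0 = s'.q 0 ∧ s.q 1 = s'.q 1 ∧ s.q 2 = s'.q 2) := by
    simp only [SameSector, funext_iff, Fin.forall_fin_succ, Fin.succ_zero_eq_one,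
      Fin.succ_one_eq_two, IsEmpty.forall_iff, and_true]
  simp only [Nondegenerate, hsector, Label.p, Label.q, Label.ell, Fin.sum_univ_three]
  simp
  constructor
  · intro h
    by_contra hc
    have hc' : (s.l12 ≠ 0 ∧ s.l23 ≠ 0 ∧ s.l31 ≠ 0) ∨ (s.l21 ≠ 0 ∧ s.l32 ≠ 0 ∧ s.l13 ≠ 0) := by
      omega
    rcases hc' with hc | hc
    · have := congrArg Label.l12 (h ⟨s.l12 - 1, s.l23 - 1, s.l31 - 1, s.l21 + 1, s.l32 + 1,
        s.l13 + 1, s.t⟩ (by dsimp only; omega) (by dsimp only; omega)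
        (by dsimp only; omega) (by dsimp only; omega) (by dsimp only; omega) (by dsimp only; omega))
      simp at this
      omega
    · have := congrArg Label.l12 (h ⟨s.l12 + 1, s.l23 + 1, s.l31 + 1, s.l21 - 1, s.l32 - 1,
        s.l13 - 1, s.t⟩ (by dsimp only; omega) (by dsimp only; omega)
        (by dsimp only; omega) (by dsimp only; omega) (by dsimp only; omega) (by dsimp only; omega))
      simp at this
  · intro h s' h0 h1 h2 h3 h4 h5
    ext <;> omega

theorem nondegenerate_iff_class (s : Label) : Nondegenerate s ↔
    ∃ I J K : Fin 3, InClassI s I J K ∨ InClassIIa s I J K ∨ InClassIIb s I J K := by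
  rw [nondegenerate_iff]
  constructor
  · rintro ⟨h | h | h, h' | h' | h'⟩
    · exact ⟨1, 2, 0, .inl ⟨by simp [AreLegs], h, h'⟩⟩
    · exact ⟨1, 2, 0, .inr (.inr ⟨by simp [AreLegs], h, h'⟩)⟩
    · exact ⟨1, 2, 0, .inr (.inl ⟨by simp [AreLegs], h, h'⟩)⟩
    · exact ⟨2, 0, 1, .inr (.inl ⟨by simp [AreLegs], h, h'⟩)⟩
    · exact ⟨2, 0, 1, .inl ⟨by simp [AreLegs], h, h'⟩⟩
    · exact ⟨2, 0, 1, .inr (.inr ⟨by simp [AreLegs], h, h'⟩)⟩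
    · exact ⟨0, 1, 2, .inr (.inr ⟨by simp [AreLegs], h, h'⟩)⟩
    · exact ⟨0, 1, 2, .inr (.inl ⟨by simp [AreLegs], h, h'⟩)⟩
    · exact ⟨0, 1, 2, .inl ⟨by simp [AreLegs], h, h'⟩⟩
  · rintro ⟨I, J, K, h⟩
    revert h
    fin_cases I <;> fin_cases J <;> fin_cases K <;>
      simp [InClassI, InClassIIa, InClassIIb, AreLegs, Label.ell] <;> omega

end LSH

end

theorem mainTheorem1 :
    -- every naive ket carries the quantum numbers of its sector
    (∀ (s : LSH.Label) (I : Fin 3),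
      LSH.numP I (LSH.naiveKet s) = (s.p I : ℂ) • LSH.naiveKet s ∧
      LSH.numQ I (LSH.naiveKet s) = (s.q I : ℂ) • LSH.naiveKet s) ∧
    -- the sectors with only one naive ket are those of the classes I, IIa and IIb
    (∀ s : LSH.Label, LSH.Nondegenerate s ↔
      ∃ I J K : Fin 3,
        LSH.InClassI s I J K ∨ LSH.InClassIIa s I J K ∨ LSH.InClassIIb s I J K) ∧
    -- squared norms, Class I
    (∀ (s : LSH.Label) (I J K : Fin 3), LSH.InClassI s I J K →
      LSH.naiveKet s =
        (LSH.LDag I J ^ s.ell I J * LSH.LDag J K ^ s.ell J K *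
          LSH.LDag J I ^ s.ell J I * LSH.LDag K J ^ s.ell K J) (LSH.tKet s.t) ∧
      ‖LSH.naiveKet s‖ ^ 2 =
        LSH.normSqI (s.ell I J) (s.ell J K) (s.ell J I) (s.ell K J) s.absT) ∧
    -- squared norms, Class IIa
    (∀ (s : LSH.Label) (I J K : Fin 3), LSH.InClassIIa s I J K →
      LSH.naiveKet s =
        (LSH.LDag I J ^ s.ell I J * LSH.LDag J K ^ s.ell J K *
          LSH.LDag J I ^ s.ell J I * LSH.LDag I K ^ s.ell I K) (LSH.tKet s.t) ∧
      ‖LSH.naiveKet s‖ ^ 2 =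
        LSH.normSqIIa (s.ell I J) (s.ell J K) (s.ell J I) (s.ell I K) s.absT) ∧
    -- squared norms, Class IIb
    (∀ (s : LSH.Label) (I J K : Fin 3), LSH.InClassIIb s I J K →
      LSH.naiveKet s =
        (LSH.LDag I J ^ s.ell I J * LSH.LDag J K ^ s.ell J K *
          LSH.LDag K J ^ s.ell K J * LSH.LDag I K ^ s.ell I K) (LSH.tKet s.t) ∧
      ‖LSH.naiveKet s‖ ^ 2 =
        LSH.normSqIIb (s.ell I J) (s.ell J K) (s.ell K J) (s.ell I K) s.absT) ∧
    -- dividing by the square roots of the closed forms gives orthonormal basis states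
    (∀ N : {s : LSH.Label // LSH.Nondegenerate s} → ℝ, (∀ s, LSH.IsClosedForm s.1 (N s)) →
      Orthonormal ℂ (fun s : {s : LSH.Label // LSH.Nondegenerate s} => LSH.unitKet s.1 (N s)) ∧
      (∀ (s : {s : LSH.Label // LSH.Nondegenerate s}) (s' : LSH.Label), s' ≠ s.1 →
        inner ℂ (LSH.unitKet s.1 (N s)) (LSH.naiveKet s') = 0) ∧
      (∀ s : {s : LSH.Label // LSH.Nondegenerate s},
        Submodule.span ℂ {LSH.unitKet s.1 (N s)} =
          Submodule.span ℂ (LSH.naiveKet '' {s' : LSH.Label | LSH.SameSector s.1 s'}))) := by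
  refine ⟨fun s I => ?_, LSH.nondegenerate_iff_class, fun s I J K h => ⟨?_, ?_⟩,
    fun s I J K h => ⟨?_, ?_⟩, fun s I J K h => ⟨?_, ?_⟩, fun N hN => ⟨⟨fun s => ?_, ?_⟩, ?_, ?_⟩⟩
  · rw [LSH.numP_apply, LSH.numQ_apply]
    exact ⟨(LSH.rep_naiveKet s).wt' true I, (LSH.rep_naiveKet s).wt' false I⟩
  · refine LSH.naiveKet_eq_of_poly_eq ?_
    rw [LSH.Label.poly_eq h.1, h.2.1, h.2.2]
    ring
  · exact LSH.norm_naiveKet_sq (LSH.hasNormSq_poly_classI h)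
  · refine LSH.naiveKet_eq_of_poly_eq ?_
    rw [LSH.Label.poly_eq h.1, h.2.1, h.2.2]
    ring
  · exact LSH.norm_naiveKet_sq (LSH.hasNormSq_poly_classIIa h)
  · refine LSH.naiveKet_eq_of_poly_eq ?_
    rw [LSH.Label.poly_eq h.1, h.2.1, h.2.2]
    ring
  · exact LSH.norm_naiveKet_sq (LSH.hasNormSq_poly_classIIb h)
  · obtain ⟨h1, h2⟩ := (hN s).norm_sq_eq
    have h3 : ‖LSH.naiveKet s.1‖ = √(N s) := by rw [← h1, Real.sqrt_sq (norm_nonneg _)]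
    change ‖LSH.unitKet s.1 (N s)‖ = 1
    rw [LSH.unitKet, norm_smul, h3, Complex.norm_real, Real.norm_of_nonneg (by positivity),
      inv_mul_cancel₀ (Real.sqrt_pos.mpr h2).ne']
  · intro s s' hss
    simp only [LSH.unitKet, inner_smul_left, inner_smul_right]
    rw [LSH.inner_naiveKet_eq_zero fun h => hss (Subtype.ext (s.2 _ h).symm), mul_zero, mul_zero]
  · intro s s' hss
    simp only [LSH.unitKet, inner_smul_left]
    rw [LSH.inner_naiveKet_eq_zero fun h => hss (s.2 _ h), mul_zero]
  · intro s
    have himage : LSH.naiveKet '' {s' : LSH.Label | LSH.SameSector s.1 s'} =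
        {LSH.naiveKet s.1} := by
      have : {s' : LSH.Label | LSH.SameSector s.1 s'} = {s.1} :=
        Set.eq_singleton_iff_unique_mem.mpr ⟨⟨rfl, rfl⟩, fun s' h => s.2 s' h⟩
      rw [this, Set.image_singleton]
    rw [himage, LSH.unitKet]
    refine Submodule.span_singleton_smul_eq (IsUnit.mk0 _ ?_) _
    exact Complex.ofReal_ne_zero.mpr (inv_ne_zero (Real.sqrt_pos.mpr (hN s).norm_sq_eq.2).ne')
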